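/- **Setting.** Let $A\in\mathbb R^{n\times n}$, $B\in\mathbb R^{n\times m}$, $C\in\mathbb R^{p\times n}$ with $(A,B)$ controllable and $(C,A)$ observable, and consider the plant $\dot x=Ax+Bu$, $y=Cx$. Let $F\in\mathbb R^{n\times n}$ be Hurwitz with $n$ distinct real eigenvalues $\lambda_1,\dots,\lambda_n$, $\Lambda=\operatorname{diag}(\lambda_1,\dots,\lambda_n)$, and put $\mu=(p+m)n$, $n_\xi=n\mu$, $n_z=n+n_\xi$. *Data.* Let $t_D>0$, let $u$ be piecewise continuous on $[0,t_D]$, and let $x$ be an absolutely continuous solution of the plant on $[0,t_D]$ (with arbitrary $x(0)$), with output $y$. Let $M:[0,t_D]\to\mathbb R^{n\times\mu}$ be the (absolutely continuous) solution of $$\dot M=FM+\begin{bmatrix}y^\top\otimes I_n & u^\top\otimes I_n\end{bmatrix},\qquad M(0)=0,$$ let $\dot\chi=\Lambda\chi$, $\chi(0)=(1,\dots,1)^\top$, and $z=(\chi,\operatorname{vec}M)$. The derivative $\dot z(t)$ denotes the value at $t$ of the right-hand sides of these two equations. *Extended system.* Choose $L\in\mathbb R^{n\times p}$ and a nonsingular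 $T\in\mathbb R^{n\times n}$ with $F=T(A-LC)T^{-1}$, let $\theta=(\operatorname{vec}(TL),\operatorname{vec}(TB))$, and let $\Gamma\in\mathbb R^{n\times n}$ satisfy $Tx(t)-M(t)\theta=\Gamma\chi(t)$ on $[0,t_D]$. Put $F_\xi=I_\mu\otimes F$, $$B_\xi=\begin{bmatrix}0\\ I_m\otimes\operatorname{vec}(I_n)\end{bmatrix},\quad L_\xi=\begin{bmatrix}I_p\otimes\operatorname{vec}(I_n)\\0\end{bmatrix},\quad C_\xi=C(\theta^\top\otimes T^{-1}),\quad A_\xi=F_\xi+L_\xi C_\xi,$$ $$A_e=\begin{bmatrix}\Lambda&0\\ L_\xi CT^{-1}\Gamma&A_\xi\end{bmatrix},\qquad B_e=\begin{bmatrix}0\\B_\xi\end{bmatrix}.$$ *Decomposition.* Let $\mathcal Z=\int_0^{t_D}z(s)z(s)^\top ds$, $l=\operatorname{rank}\mathcal Z$, let $\mathcal Z=\mathcal U\operatorname{diag}(\sigma_1,\dots,\sigma_l,0,\dots,0)\,\mathcal U^\top$ with $\mathcal U$ orthogonal and $\sigma_1\ge\dots\ge\sigma_l>0$, put $T_z=\mathcal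 U^\top$, and let $z_a$ and $\dot z_a$ be the first $l$ entries of $T_zz$ and $T_z\dot z$. *Excitation assumption.* With $\mathcal R=[B_e\ \ A_eB_e\ \cdots\ A_e^{n_z-1}B_e]$, assume $$\operatorname{Im}\mathcal R\subseteq\operatorname{Im}\mathcal Z\qquad\text{and}\qquad\int_0^{t_D}\begin{bmatrix}z_a(s)\\u(s)\end{bmatrix}\begin{bmatrix}z_a(s)\\u(s)\end{bmatrix}^\top ds\succ0 .$$ **Theorem.** Matrices $T,L,\Gamma$ as above exist (without the excitation assumption). For every choice of them, and of $\mathcal U$, for which the excitation assumption holds: 1. There are $N\ge1$ and instants $0\le t_1<\dots<t_N\le t_D$ such that the batches $Z_a=[z_a(t_1)\cdots z_a(t_N)]$ and $U=[u(t_1)\cdots u(t_N)]$ satisfy $\operatorname{rank}\begin{bmatrix}Z_a\\U\end{bmatrix}=l+m$. 2. For all $N\ge1$ and all such instants, with $\dot Z_a=[\dot z_a(t_1)\cdots\dot z_a(t_N)]$, the LMI $$Z_aQ=Q^\top Z_a^\top\succ0,\qquad \dot Z_aQ+Q^\top\dot Z_a^\top\prec0$$ has a solution $Q\in\mathbb R^{N\times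 l}$, and for every solution $Q$ the gain $K_e=\begin{bmatrix}UQ(Z_aQ)^{-1}&0_{m\times(n_z-l)}\end{bmatrix}T_z$ makes $A_e+B_eK_e$ Hurwitz. 3. For every such $K_e$, the controller $$\dot M=FM+\begin{bmatrix}y^\top\otimes I_n&u^\top\otimes I_n\end{bmatrix},\qquad u=K_e\begin{bmatrix}0_n\\\operatorname{vec}(M)\end{bmatrix}$$ is a linear dynamic output-feedback controller $\dot x_c=A_cx_c+B_cy$, $u=C_cx_c+D_cy$ with state $x_c=\operatorname{vec}(M)$, and the origin $(x,x_c)=0$ of its interconnection with the plant is globally exponentially stable: there are $c,\alpha>0$ such that a solution on $[0,\infty)$ exists from every initial state $(x(0),x_c(0))$ and every solution satisfies $|(x(t),x_c(t))|\le c\,e^{-\alpha t}|(x(0),x_c(0))|$ for all $t\ge0$. -/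

import Mathlib

open Matrix MeasureTheory Set
open scoped Kronecker Topology

namespace FilterStab

noncomputable section

/-! ### Linear systems -/

/-- A real square matrix is Hurwitz if all its complex eigenvalues have negative real part. -/
def IsHurwitz {ι : Type*} [Fintype ι] [DecidableEq ι] (A : Matrix ι ι ℝ) : Prop :=
  ∀ s ∈ spectrum ℂ (A.map (fun r : ℝ => (r : ℂ))), s.re < 0

/-- The reachability matrix `[B  AB  ⋯  A^(d-1) B]`, where `d` is the dimension of the state. -/
def reachMatrix {ι κ : Type*} [Fintype ι] [DecidableEq ι]
    (A : Matrix ι ι ℝ) (B : Matrix ι κ ℝ) : Matrix ι (Fin (Fintype.card ι) × κ) ℝ :=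
  Matrix.of fun i kj => (A ^ (kj.1 : ℕ) * B) i kj.2

/-- The observability matrix: the matrices `C, CA, …, C A^(d-1)` stacked on top of each other. -/
def obsMatrix {ι κ : Type*} [Fintype ι] [DecidableEq ι]
    (C : Matrix κ ι ℝ) (A : Matrix ι ι ℝ) : Matrix (Fin (Fintype.card ι) × κ) ι ℝ :=
  Matrix.of fun ki j => (C * A ^ (ki.1 : ℕ)) ki.2 j

def IsControllable {ι κ : Type*} [Fintype ι] [DecidableEq ι] [Fintype κ]
    (A : Matrix ι ι ℝ) (B : Matrix ι κ ℝ) : Prop :=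
  (reachMatrix A B).rank = Fintype.card ι

def IsObservable {ι κ : Type*} [Fintype ι] [DecidableEq ι]
    (C : Matrix κ ι ℝ) (A : Matrix ι ι ℝ) : Prop :=
  (obsMatrix C A).rank = Fintype.card ι

/-! ### Signals and solutions of differential equations -/

/-- Piecewise continuity on `[a, b]`: finitely many discontinuities, and finite one-sided limits
everywhere. -/
def PiecewiseContinuousOn {ι : Type*} (u : ℝ → ι → ℝ) (a b : ℝ) : Prop :=
  (∃ S : Finset ℝ, ∀ t ∈ Icc a b, t ∉ S → ContinuousWithinAt u (Icc a b) t) ∧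
  (∀ t ∈ Ico a b, ∃ v, Filter.Tendsto u (𝓝[>] t) (𝓝 v)) ∧
  (∀ t ∈ Ioc a b, ∃ v, Filter.Tendsto u (𝓝[<] t) (𝓝 v))

/-- `f` is an absolutely continuous function on `[a, b]` with `f' = g` almost everywhere
on `[a, b]`. -/
def IsACSolution {ι : Type*} (a b : ℝ) (f g : ℝ → ι → ℝ) : Prop :=
  ∀ i, AbsolutelyContinuousOnInterval (fun t => f t i) a b ∧
    ∀ᵐ t ∂(volume.restrict (Icc a b)), HasDerivAt (fun s => f s i) (g t i) t

/-- The Gram matrix `∫₀^τ w(s) w(s)ᵀ ds` of a vector signal. -/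
def gramSig {ι : Type*} (τ : ℝ) (w : ℝ → ι → ℝ) : Matrix ι ι ℝ :=
  Matrix.of fun i j => ∫ s in (0 : ℝ)..τ, w s i * w s j

/-- `φ` solves `φ' = f(φ)` on `[0, ∞)`. -/
def IsForwardSolution {ι : Type*} [Fintype ι] (f : (ι → ℝ) → ι → ℝ) (φ : ℝ → ι → ℝ) : Prop :=
  ∀ t, 0 ≤ t → HasDerivWithinAt φ (f (φ t)) (Ici 0) t

/-- Global exponential stability of the origin of `w' = f(w)`, with respect to the Euclidean norm:
there is a forward solution from each initial state, and all forward solutions decay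
exponentially at a uniform rate and with a uniform constant. -/
def IsGES {ι : Type*} [Fintype ι] (f : (ι → ℝ) → ι → ℝ) : Prop :=
  (∀ w₀ : ι → ℝ, ∃ φ, φ 0 = w₀ ∧ IsForwardSolution f φ) ∧
  ∃ c > 0, ∃ α > 0, ∀ φ, IsForwardSolution f φ → ∀ t, 0 ≤ t →
    ‖WithLp.toLp 2 (φ t)‖ ≤ c * Real.exp (-α * t) * ‖WithLp.toLp 2 (φ 0)‖

/-! ### The filter -/

variable {n m p : ℕ}

/-- Column index of the filter state `M`; it has `(p + m) n` elements. -/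
abbrev MuIdx (n m p : ℕ) : Type := (Fin p × Fin n) ⊕ (Fin m × Fin n)

/-- Index of `vec M` (pairs: column of `M`, row of `M`). -/
abbrev XiIdx (n m p : ℕ) : Type := MuIdx n m p × Fin n

/-- Index of the extended state `z = (χ, vec M)`. -/
abbrev ZIdx (n m p : ℕ) : Type := Fin n ⊕ XiIdx n m p

/-- The matrix `vᵀ ⊗ S`, with its one-point row index removed. -/
def rowKron {α β γ : Type*} (v : α → ℝ) (S : Matrix β γ ℝ) : Matrix β (α × γ) ℝ :=
  (Matrix.replicateRow Unit v ⊗ₖ S).submatrix (fun i => ((), i)) id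

/-- The block matrix `[yᵀ ⊗ Iₙ   uᵀ ⊗ Iₙ]` that drives the filter. -/
def filterInput (n : ℕ) (y : Fin p → ℝ) (u : Fin m → ℝ) : Matrix (Fin n) (MuIdx n m p) ℝ :=
  Matrix.fromCols (rowKron y (1 : Matrix (Fin n) (Fin n) ℝ))
    (rowKron u (1 : Matrix (Fin n) (Fin n) ℝ))

/-- The right-hand side of the filter `M' = F M + [yᵀ ⊗ Iₙ   uᵀ ⊗ Iₙ]`. -/
def filterRHS (F : Matrix (Fin n) (Fin n) ℝ) (M : Matrix (Fin n) (MuIdx n m p) ℝ)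
    (y : Fin p → ℝ) (u : Fin m → ℝ) : Matrix (Fin n) (MuIdx n m p) ℝ :=
  F * M + filterInput n y u

/-- The auxiliary signal `χ(t) = (e^{λ₁ t}, …, e^{λₙ t})`. -/
def chi (lam : Fin n → ℝ) (t : ℝ) : Fin n → ℝ := fun i => Real.exp (lam i * t)

/-- `χ` starts at `(1, …, 1)` and solves `χ' = Λ χ` with `Λ = diag(λ₁, …, λₙ)`. -/
theorem chi_spec (lam : Fin n → ℝ) :
    chi lam 0 = 1 ∧ ∀ t, HasDerivAt (chi lam) (Matrix.diagonal lam *ᵥ chi lam t) t := by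
  refine ⟨by ext i; simp [chi], fun t => ?_⟩
  rw [hasDerivAt_pi]
  intro i
  have h : HasDerivAt (fun s : ℝ => lam i * s) (lam i) t := by
    simpa using (hasDerivAt_id t).const_mul (lam i)
  simpa [chi, Matrix.mulVec_diagonal, mul_comm] using h.exp

/-- The filtered signal `z = (χ, vec M)`. -/
def zSig (lam : Fin n → ℝ) (M : ℝ → Matrix (Fin n) (MuIdx n m p) ℝ) (t : ℝ) :
    ZIdx n m p → ℝ :=
  Sum.elim (chi lam t) (Matrix.vec (M t))

/-- The available derivative of `z`: the right-hand side of the implemented equations of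
`χ` and `M`, at each time `t`. -/
def zDot (F : Matrix (Fin n) (Fin n) ℝ) (lam : Fin n → ℝ)
    (M : ℝ → Matrix (Fin n) (MuIdx n m p) ℝ) (y : ℝ → Fin p → ℝ) (u : ℝ → Fin m → ℝ) (t : ℝ) :
    ZIdx n m p → ℝ :=
  Sum.elim (Matrix.diagonal lam *ᵥ chi lam t) (Matrix.vec (filterRHS F (M t) (y t) (u t)))

/-! ### The non-minimal realization and the extended system -/

/-- `θ = (vec(T L), vec(T B))`. -/
def theta (B : Matrix (Fin n) (Fin m) ℝ) (T : Matrix (Fin n) (Fin n) ℝ)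
    (L : Matrix (Fin n) (Fin p) ℝ) : MuIdx n m p → ℝ :=
  Sum.elim (Matrix.vec (T * L)) (Matrix.vec (T * B))

/-- `T`, `L` and `Γ` are admissible for the data: `T` is nonsingular, `F = T (A - L C) T⁻¹`, and the
transverse coordinate `β = T x - M θ` is `β(t) = Γ χ(t)` on the interval of the experiment. -/
structure IsAdmissible (A : Matrix (Fin n) (Fin n) ℝ) (B : Matrix (Fin n) (Fin m) ℝ)
    (C : Matrix (Fin p) (Fin n) ℝ) (F : Matrix (Fin n) (Fin n) ℝ) (lam : Fin n → ℝ) (tD : ℝ)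
    (x : ℝ → Fin n → ℝ) (M : ℝ → Matrix (Fin n) (MuIdx n m p) ℝ)
    (T : Matrix (Fin n) (Fin n) ℝ) (L : Matrix (Fin n) (Fin p) ℝ)
    (Γ : Matrix (Fin n) (Fin n) ℝ) : Prop where
  nonsing : IsUnit T.det
  similar : F = T * (A - L * C) * T⁻¹
  transverse : ∀ t ∈ Icc 0 tD, T *ᵥ x t - M t *ᵥ theta B T L = Γ *ᵥ chi lam t

/-- `F_ξ = I ⊗ F`. -/
def Fxi (m p : ℕ) (F : Matrix (Fin n) (Fin n) ℝ) : Matrix (XiIdx n m p) (XiIdx n m p) ℝ :=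
  (1 : Matrix (MuIdx n m p) (MuIdx n m p) ℝ) ⊗ₖ F

/-- `B_ξ`: the block `0` on top of `I_m ⊗ vec(Iₙ)`. -/
def Bxi (n m p : ℕ) : Matrix (XiIdx n m p) (Fin m) ℝ :=
  Matrix.of fun r c =>
    match r with
    | (Sum.inl _, _) => 0
    | (Sum.inr (j, k), i) =>
        (1 : Matrix (Fin m) (Fin m) ℝ) j c * Matrix.vec (1 : Matrix (Fin n) (Fin n) ℝ) (k, i)

/-- `L_ξ`: the block `I_p ⊗ vec(Iₙ)` on top of `0`. -/
def Lxi (n m p : ℕ) : Matrix (XiIdx n m p) (Fin p) ℝ :=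
  Matrix.of fun r c =>
    match r with
    | (Sum.inl (j, k), i) =>
        (1 : Matrix (Fin p) (Fin p) ℝ) j c * Matrix.vec (1 : Matrix (Fin n) (Fin n) ℝ) (k, i)
    | (Sum.inr _, _) => 0

/-- `C_ξ = C (θᵀ ⊗ T⁻¹)`. -/
def Cxi (B : Matrix (Fin n) (Fin m) ℝ) (C : Matrix (Fin p) (Fin n) ℝ)
    (T : Matrix (Fin n) (Fin n) ℝ) (L : Matrix (Fin n) (Fin p) ℝ) :
    Matrix (Fin p) (XiIdx n m p) ℝ :=
  C * rowKron (theta B T L) T⁻¹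

/-- `A_ξ = F_ξ + L_ξ C_ξ`. -/
def Axi (B : Matrix (Fin n) (Fin m) ℝ) (C : Matrix (Fin p) (Fin n) ℝ)
    (F T : Matrix (Fin n) (Fin n) ℝ) (L : Matrix (Fin n) (Fin p) ℝ) :
    Matrix (XiIdx n m p) (XiIdx n m p) ℝ :=
  Fxi m p F + Lxi n m p * Cxi B C T L

/-- The state matrix of the extended system `z' = A_e z + B_e u`. -/
def Ae (B : Matrix (Fin n) (Fin m) ℝ) (C : Matrix (Fin p) (Fin n) ℝ)
    (F : Matrix (Fin n) (Fin n) ℝ) (lam : Fin n → ℝ)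
    (T : Matrix (Fin n) (Fin n) ℝ) (L : Matrix (Fin n) (Fin p) ℝ)
    (Γ : Matrix (Fin n) (Fin n) ℝ) : Matrix (ZIdx n m p) (ZIdx n m p) ℝ :=
  Matrix.fromBlocks (Matrix.diagonal lam) 0 (Lxi n m p * C * T⁻¹ * Γ) (Axi B C F T L)

/-- The input matrix of the extended system. -/
def Be (n m p : ℕ) : Matrix (ZIdx n m p) (Fin m) ℝ :=
  Matrix.fromRows 0 (Bxi n m p)

/-! ### The algorithm -/

/-- `Tz = 𝒰ᵀ`, with rows split into the first `l` and the remaining `k`, comes from a singular value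
decomposition `𝒵 = 𝒰 diag(σ₁, …, σ_l, 0, …, 0) 𝒰ᵀ` with `l = rank 𝒵` and
`σ₁ ≥ ⋯ ≥ σ_l > 0`. -/
structure IsDecomposition {ι : Type*} [Fintype ι] [DecidableEq ι] (Zg : Matrix ι ι ℝ) {l k : ℕ}
    (Tz : Matrix (Fin l ⊕ Fin k) ι ℝ) : Prop where
  rank_eq : Zg.rank = l
  card_eq : l + k = Fintype.card ι
  orth_left : Tz * Tzᵀ = 1
  orth_right : Tzᵀ * Tz = 1
  svd : ∃ σ : Fin l → ℝ, Antitone σ ∧ (∀ i, 0 < σ i) ∧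
    Zg = Tzᵀ * Matrix.diagonal (Sum.elim σ (0 : Fin k → ℝ)) * Tz

/-- The part `w_a` (first `l` coordinates) of `Tz w`. -/
def partA {ι : Type*} [Fintype ι] {l k : ℕ} (Tz : Matrix (Fin l ⊕ Fin k) ι ℝ)
    (w : ℝ → ι → ℝ) (t : ℝ) : Fin l → ℝ :=
  fun i => (Tz *ᵥ w t) (Sum.inl i)

/-- The data batch `[w(t₁) ⋯ w(t_N)]`. -/
def batch {ι : Type*} {N : ℕ} (w : ℝ → ι → ℝ) (ts : Fin N → ℝ) : Matrix ι (Fin N) ℝ :=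
  Matrix.of fun i j => w (ts j) i

/-- Admissible sampling instants: `0 ≤ t₁ < ⋯ < t_N ≤ t_D` with `rank [Z_a; U] = l + m`. -/
structure IsSampling {l N : ℕ} (tD : ℝ) (za : ℝ → Fin l → ℝ) (u : ℝ → Fin m → ℝ)
    (ts : Fin N → ℝ) : Prop where
  strictMono : StrictMono ts
  mem : ∀ j, ts j ∈ Icc 0 tD
  rank_eq : (Matrix.fromRows (batch za ts) (batch u ts)).rank = l + m

/-- `Q` solves the linear matrix inequality `Z_a Q = Qᵀ Z_aᵀ ≻ 0`, `Ż_a Q + Qᵀ Ż_aᵀ ≺ 0`. -/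
structure IsLMISolution {l N : ℕ} (Za Zadot : Matrix (Fin l) (Fin N) ℝ)
    (Q : Matrix (Fin N) (Fin l) ℝ) : Prop where
  symm : Za * Q = Qᵀ * Zaᵀ
  pos : (Za * Q).PosDef
  neg : (-(Zadot * Q + Qᵀ * Zadotᵀ)).PosDef

/-- The gain `K_e = [U Q (Z_a Q)⁻¹   0] T_z`. -/
def gain {ι : Type*} {l k N : ℕ} (Za : Matrix (Fin l) (Fin N) ℝ) (U : Matrix (Fin m) (Fin N) ℝ)
    (Q : Matrix (Fin N) (Fin l) ℝ) (Tz : Matrix (Fin l ⊕ Fin k) ι ℝ) : Matrix (Fin m) ι ℝ :=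
  Matrix.fromCols (U * Q * (Za * Q)⁻¹) (0 : Matrix (Fin m) (Fin k) ℝ) * Tz

/-! ### The closed loop -/

/-- The interconnection of the plant `x' = A x + B u`, `y = C x` with the dynamic output-feedback
controller `x_c' = A_c x_c + B_c y`, `u = C_c x_c + D_c y`. -/
def closedLoop {κ : Type*} [Fintype κ]
    (A : Matrix (Fin n) (Fin n) ℝ) (B : Matrix (Fin n) (Fin m) ℝ) (C : Matrix (Fin p) (Fin n) ℝ)
    (Ac : Matrix κ κ ℝ) (Bc : Matrix κ (Fin p) ℝ) (Cc : Matrix (Fin m) κ ℝ)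
    (Dc : Matrix (Fin m) (Fin p) ℝ) (w : Fin n ⊕ κ → ℝ) : Fin n ⊕ κ → ℝ :=
  let x : Fin n → ℝ := fun i => w (Sum.inl i)
  let xc : κ → ℝ := fun i => w (Sum.inr i)
  let y := C *ᵥ x
  let u := Cc *ᵥ xc + Dc *ᵥ y
  Sum.elim (A *ᵥ x + B *ᵥ u) (Ac *ᵥ xc + Bc *ᵥ y)

/-- The controller `x_c' = A_c x_c + B_c y`, `u = C_c x_c + D_c y` is, with `x_c = vec M`, the
filter-based controller `M' = F M + [yᵀ ⊗ Iₙ   uᵀ ⊗ Iₙ]`, `u = K_e (0, vec M)`. -/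
def IsFilterController (F : Matrix (Fin n) (Fin n) ℝ) (Ke : Matrix (Fin m) (ZIdx n m p) ℝ)
    (Ac : Matrix (XiIdx n m p) (XiIdx n m p) ℝ) (Bc : Matrix (XiIdx n m p) (Fin p) ℝ)
    (Cc : Matrix (Fin m) (XiIdx n m p) ℝ) (Dc : Matrix (Fin m) (Fin p) ℝ) : Prop :=
  ∀ (M : Matrix (Fin n) (MuIdx n m p) ℝ) (y : Fin p → ℝ),
    Ke *ᵥ Sum.elim 0 (Matrix.vec M) = Cc *ᵥ Matrix.vec M + Dc *ᵥ y ∧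
    Matrix.vec (filterRHS F M y (Ke *ᵥ Sum.elim 0 (Matrix.vec M))) =
      Ac *ᵥ Matrix.vec M + Bc *ᵥ y

/-- The filter-based controller with gain `K_e` is a linear dynamic output-feedback controller
whose interconnection with the plant has a globally exponentially stable origin
`(x, vec M) = 0`. -/
def FilterControllerStabilizes (A : Matrix (Fin n) (Fin n) ℝ) (B : Matrix (Fin n) (Fin m) ℝ)
    (C : Matrix (Fin p) (Fin n) ℝ) (F : Matrix (Fin n) (Fin n) ℝ)
    (Ke : Matrix (Fin m) (ZIdx n m p) ℝ) : Prop :=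
  ∃ Ac Bc Cc Dc, IsFilterController F Ke Ac Bc Cc Dc ∧ IsGES (closedLoop A B C Ac Bc Cc Dc)

end

end FilterStab

open FilterStab

/-! The transverse coordinate `β = T x - M θ` obeys `β' = F β`, so along the data `z = (χ, vec M)`
satisfies `z' = A_e z + B_e u` exactly. Write `R = θᵀ ⊗ T⁻¹`, so that `R vec M = T⁻¹ M θ`. This map
intertwines `(A_ξ, B_ξ)` with `(A, B)`, and on its kernel `A_ξ` acts as `F_ξ`. Hence a gain `K` that
stabilizes the plant lifts to `K R` (`isHurwitz_Axi_add`) and, `Λ` being Hurwitz, to a stabilizing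
gain for the extended system.

The data live in `Im 𝒵`. This subspace contains `Im B_e` by the range condition, and it is
`A_e`-invariant because the coordinates of `T_z z` beyond the first `l` vanish identically, hence so
do their derivatives (`toBlocks₂₁_conj_eq_zero`). In the coordinates `T_z` every closed loop is
therefore block triangular, with an unexcited block that does not depend on the gain. The lifted
gain, which need not be known from data, shows that this block is Hurwitz and that the excited pair
`(A_a, B_a)` is stabilizable (`isHurwitz_add_mul_iff`).

On the excited part `Ż_a = A_a Z_a + B_a U`, so the LMI is a Lyapunov inequality with certificate `P
= Z_a Q` for `A_a + B_a U Q (Z_a Q)⁻¹`. Full row rank of the data lets some `Q` produce any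
prescribed pair `(P, K_a P)`, which gives feasibility.

In the coordinates `(x - R ξ, ξ)` the plant with the controller is block triangular, with diagonal
blocks `A - L C`, similar to `F`, and `A_ξ + B_ξ K_ξ`, where `K_ξ` consists of the columns of `K_e`
acting on `ξ` (`isHurwitz_interconnection`). The matrices `T`, `L` come from assigning the
eigenvalues of `F` to `A - L C` (`exists_outputInjection_hasEigenvalue`). -/

namespace FilterStab

/-! ### Hurwitz matrices: similarity, block-triangular forms, Lyapunov's theorem -/

section Hurwitz

variable {ι κ : Type*} [Fintype ι] [DecidableEq ι] [Fintype κ] [DecidableEq κ]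

/-- The complexification of a real matrix. -/
abbrev cplx {α β : Type*} (A : Matrix α β ℝ) : Matrix α β ℂ := A.map (fun r : ℝ => (r : ℂ))

theorem cplx_mul {α β γ : Type*} [Fintype β] (A : Matrix α β ℝ) (B : Matrix β γ ℝ) :
    cplx (A * B) = cplx A * cplx B :=
  Matrix.map_mul (f := Complex.ofRealHom)

theorem cplx_add {α β : Type*} (A B : Matrix α β ℝ) : cplx (A + B) = cplx A + cplx B :=
  Matrix.map_add _ Complex.ofReal_add A B

theorem cplx_one {α : Type*} [DecidableEq α] : cplx (1 : Matrix α α ℝ) = 1 :=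
  Matrix.map_one _ Complex.ofReal_zero Complex.ofReal_one

theorem cplx_transpose {α β : Type*} (A : Matrix α β ℝ) : cplx Aᵀ = (cplx A)ᴴ := by
  ext i j
  simp [cplx]

theorem mem_spectrum_iff_mulVec (A : Matrix ι ι ℂ) (s : ℂ) :
    s ∈ spectrum ℂ A ↔ ∃ v : ι → ℂ, v ≠ 0 ∧ A *ᵥ v = s • v := by
  rw [← Matrix.spectrum_toLin', ← Module.End.hasEigenvalue_iff_mem_spectrum]
  constructor
  · intro h
    obtain ⟨v, hv⟩ := h.exists_hasEigenvector
    exact ⟨v, hv.2, by simpa using hv.apply_eq_smul⟩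
  · rintro ⟨v, hv, h⟩
    exact Module.End.hasEigenvalue_of_hasEigenvector (x := v)
      ⟨Module.End.mem_eigenspace_iff.2 (by simpa using h), hv⟩

theorem isHurwitz_iff (A : Matrix ι ι ℝ) :
    IsHurwitz A ↔ ∀ (s : ℂ) (v : ι → ℂ), v ≠ 0 → cplx A *ᵥ v = s • v → s.re < 0 := by
  simp only [IsHurwitz, mem_spectrum_iff_mulVec]
  exact ⟨fun h s v h1 h2 => h s ⟨v, h1, h2⟩, fun h s ⟨v, h1, h2⟩ => h s v h1 h2⟩

/-- This form suits transposes and block-triangular matrices, where characteristic polynomials agree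
or multiply; the eigenvector form suits similarity and intertwining. -/
theorem isHurwitz_iff_charpoly (A : Matrix ι ι ℝ) :
    IsHurwitz A ↔ ∀ s : ℂ, (cplx A).charpoly.IsRoot s → s.re < 0 := by
  simp only [IsHurwitz, Matrix.mem_spectrum_iff_isRoot_charpoly]

theorem isHurwitz_transpose {A : Matrix ι ι ℝ} : IsHurwitz Aᵀ ↔ IsHurwitz A := by
  rw [isHurwitz_iff_charpoly, isHurwitz_iff_charpoly, cplx, Matrix.transpose_map,
    Matrix.charpoly_transpose]

theorem isHurwitz_fromBlocks_zero₂₁ {X : Matrix ι ι ℝ} {Y : Matrix ι κ ℝ} {W : Matrix κ κ ℝ} :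
    IsHurwitz (Matrix.fromBlocks X Y 0 W) ↔ IsHurwitz X ∧ IsHurwitz W := by
  simp only [isHurwitz_iff_charpoly, cplx, Matrix.fromBlocks_map]
  rw [show (0 : Matrix κ ι ℝ).map (fun r : ℝ => (r : ℂ)) = 0 by ext; simp,
    Matrix.charpoly_fromBlocks_zero₂₁]
  simp only [Polynomial.IsRoot, Polynomial.eval_mul, mul_eq_zero]
  exact ⟨fun h => ⟨fun s hs => h s (.inl hs), fun s hs => h s (.inr hs)⟩,
    fun h s hs => hs.elim (h.1 s) (h.2 s)⟩

theorem isHurwitz_fromBlocks_zero₁₂ {X : Matrix ι ι ℝ} {Y : Matrix κ ι ℝ} {W : Matrix κ κ ℝ} :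
    IsHurwitz (Matrix.fromBlocks X 0 Y W) ↔ IsHurwitz X ∧ IsHurwitz W := by
  rw [← isHurwitz_transpose, Matrix.fromBlocks_transpose, Matrix.transpose_zero,
    isHurwitz_fromBlocks_zero₂₁, isHurwitz_transpose, isHurwitz_transpose]

/-- The two index types may differ, so that `Tz`, which passes from `ι` to `Fin l ⊕ Fin k`, is
covered. -/
theorem IsHurwitz.conj {A : Matrix ι ι ℝ} (hA : IsHurwitz A) {P : Matrix κ ι ℝ} {R : Matrix ι κ ℝ}
    (hPR : P * R = 1) (hRP : R * P = 1) : IsHurwitz (P * A * R) := by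
  rw [isHurwitz_iff] at hA ⊢
  intro s v hv h
  have hPR' : cplx P * cplx R = 1 := by rw [← cplx_mul, hPR, cplx_one]
  have hRP' : cplx R * cplx P = 1 := by rw [← cplx_mul, hRP, cplx_one]
  refine hA s (cplx R *ᵥ v) (fun h0 => hv ?_) ?_
  · rw [← Matrix.one_mulVec v, ← hPR', ← Matrix.mulVec_mulVec, h0, Matrix.mulVec_zero]
  · rw [cplx_mul, cplx_mul] at h
    have := congrArg (cplx R *ᵥ ·) h
    simp only [Matrix.mulVec_mulVec, Matrix.mulVec_smul] at this
    rwa [← Matrix.mul_assoc, ← Matrix.mul_assoc, hRP', Matrix.one_mul, ← Matrix.mulVec_mulVec] at this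

/-! ### Lyapunov inequalities -/

/-- No symmetry of `N` is needed: for `v = a + i b` the cross terms are purely imaginary. -/
theorem re_star_dotProduct_cplx_mulVec {α : Type*} [Fintype α] (N : Matrix α α ℝ) (v : α → ℂ) :
    (star v ⬝ᵥ cplx N *ᵥ v).re =
      (fun i => (v i).re) ⬝ᵥ N *ᵥ (fun i => (v i).re) +
        (fun i => (v i).im) ⬝ᵥ N *ᵥ (fun i => (v i).im) := by
  simp only [dotProduct, Matrix.mulVec, cplx, Matrix.map_apply, Complex.re_sum, Pi.star_apply,
    ← Finset.sum_add_distrib, Complex.mul_re, Complex.im_sum, Complex.mul_im]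
  refine Finset.sum_congr rfl fun i _ => ?_
  simp

theorem re_star_dotProduct_cplx_mulVec_pos {α : Type*} [Fintype α] {N : Matrix α α ℝ}
    (hN : N.PosDef) {v : α → ℂ}
    (hv : v ≠ 0) : 0 < (star v ⬝ᵥ cplx N *ᵥ v).re := by
  rw [re_star_dotProduct_cplx_mulVec]
  have h1 := hN.posSemidef.dotProduct_mulVec_nonneg (fun i => (v i).re)
  have h2 := hN.posSemidef.dotProduct_mulVec_nonneg (fun i => (v i).im)
  simp only [star_trivial] at h1 h2
  by_cases h : (fun i => (v i).re) = 0
  · have h' : (fun i => (v i).im) ≠ 0 := by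
      intro h'
      apply hv
      ext i
      exact Complex.ext (congrFun h i) (congrFun h' i)
    have := hN.dotProduct_mulVec_pos h'
    simp only [star_trivial] at this
    linarith
  · have := hN.dotProduct_mulVec_pos h
    simp only [star_trivial] at this
    linarith

/-- A matrix that satisfies a strict Lyapunov inequality is Hurwitz. -/
theorem isHurwitz_of_lyapunov {H P : Matrix ι ι ℝ} (hP : P.PosDef)
    (hN : (-(H * P + P * Hᵀ)).PosDef) : IsHurwitz H := by
  -- An eigenvector of `Hᵀ` is a left eigenvector of `H` after conjugation, and on it the Lyapunov
  -- form equals `-2 Re s · v* P v`.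
  rw [← isHurwitz_transpose, isHurwitz_iff]
  intro s v hv h
  have h1 := re_star_dotProduct_cplx_mulVec_pos hP hv
  have h2 := re_star_dotProduct_cplx_mulVec_pos hN hv
  have h3 : star v ᵥ* cplx H = star s • star v := by
    rw [← star_smul, ← h, Matrix.star_mulVec, cplx_transpose, Matrix.conjTranspose_conjTranspose]
  have h4 : cplx (-(H * P + P * Hᵀ)) = -(cplx H * cplx P + cplx P * cplx Hᵀ) := by
    rw [← cplx_mul, ← cplx_mul, ← cplx_add]
    ext; simp [cplx]
  rw [h4, Matrix.neg_mulVec, Matrix.add_mulVec, ← Matrix.mulVec_mulVec, ← Matrix.mulVec_mulVec, h,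
    dotProduct_neg, dotProduct_add, Matrix.dotProduct_mulVec (star v) (cplx H), h3,
    Matrix.mulVec_smul, smul_dotProduct, dotProduct_smul, ← add_smul] at h2
  have h5 : star s + s = ((2 * s.re : ℝ) : ℂ) := by
    apply Complex.ext <;> simp; ring
  rw [h5, Complex.neg_re, smul_eq_mul, Complex.re_ofReal_mul] at h2
  nlinarith

open scoped ComplexOrder in
-- Real vectors see only the real part of a Hermitian form. This brings a complex solution of the
-- Lyapunov inequality back to a real one.
theorem posDef_map_re {α : Type*} [Fintype α] {P : Matrix α α ℂ}
    (hP : P.PosDef) : (P.map Complex.re).PosDef := by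
  refine Matrix.PosDef.of_dotProduct_mulVec_pos ?_ fun {x} hx => ?_
  · ext i j
    have := congrArg Complex.re (hP.isHermitian.apply i j)
    simpa using this
  · have h0 : (fun i => (x i : ℂ)) ≠ 0 := by
      intro h
      apply hx
      ext i
      simpa using congrFun h i
    have h1 := (Complex.pos_iff.1 (hP.dotProduct_mulVec_pos h0)).1
    have h2 : (star (fun i => (x i : ℂ)) ⬝ᵥ P *ᵥ fun i => (x i : ℂ)).re =
        star x ⬝ᵥ P.map Complex.re *ᵥ x := by
      simp [dotProduct, Matrix.mulVec]
    rwa [h2] at h1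

theorem map_re_cplx_mul {α β γ : Type*} [Fintype β] (H : Matrix α β ℝ) (P : Matrix β γ ℂ) :
    (cplx H * P).map Complex.re = H * P.map Complex.re := by
  ext i j
  simp [Matrix.mul_apply]

theorem map_re_mul_cplx {α β γ : Type*} [Fintype β] (P : Matrix α β ℂ) (H : Matrix β γ ℝ) :
    (P * cplx H).map Complex.re = P.map Complex.re * H := by
  ext i j
  simp [Matrix.mul_apply]

open scoped Matrix.Norms.L2Operator ComplexOrder in
/-- The discrete Lyapunov equation is solvable when the spectral radius is smaller than one. -/
theorem exists_posDef_stein {S : Matrix ι ι ℂ} (hS : ∀ s ∈ spectrum ℂ S, ‖s‖ < 1) :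
    ∃ P : Matrix ι ι ℂ, P.PosDef ∧ P = 1 + S * P * Sᴴ := by
  rcases isEmpty_or_nonempty ι with hι | hι
  · exact ⟨1, Matrix.PosDef.one, Subsingleton.elim _ _⟩
  have hr : spectralRadius ℂ S < 1 := by
    have := spectrum.spectralRadius_lt_of_forall_lt S (r := 1) (fun k hk => by
      have := hS k hk
      exact_mod_cast this)
    simpa using this
  obtain ⟨r, hr1, hr2⟩ := ENNReal.lt_iff_exists_nnreal_btwn.1 hr
  have hr2' : (r : ℝ) < 1 := by exact_mod_cast hr2
  -- Gelfand's formula gives geometric decay of `‖S ^ k‖`, so `∑ S ^ k (S ^ k)ᴴ` converges;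
  -- splitting off its first term gives the equation.
  have hev : ∀ᶠ k : ℕ in Filter.atTop, ‖S ^ k‖ ≤ (r : ℝ) ^ k := by
    filter_upwards [(spectrum.pow_nnnorm_pow_one_div_tendsto_nhds_spectralRadius S).eventually_lt_const hr1,
      Filter.eventually_gt_atTop 0] with k hk hk0
    have h1 : ((‖S ^ k‖₊ : ENNReal)) ≤ (r : ENNReal) ^ k := by
      have h2 := ENNReal.rpow_le_rpow hk.le (z := (k : ℝ)) (by positivity)
      rw [← ENNReal.rpow_mul, one_div, inv_mul_cancel₀ (by positivity), ENNReal.rpow_one,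
        ENNReal.rpow_natCast] at h2
      exact h2
    exact_mod_cast h1
  have hsum : Summable fun k : ℕ => S ^ k * (S ^ k)ᴴ := by
    refine Summable.of_norm_bounded_eventually_nat
      (summable_geometric_of_lt_one (r := (r : ℝ)) r.2 hr2') ?_
    filter_upwards [hev] with k hk
    have h3 : (r : ℝ) ^ k ≤ 1 := pow_le_one₀ r.2 hr2'.le
    have h4 : (0 : ℝ) ≤ (r : ℝ) ^ k := pow_nonneg r.2 k
    calc ‖S ^ k * (S ^ k)ᴴ‖ ≤ ‖S ^ k‖ * ‖(S ^ k)ᴴ‖ := norm_mul_le _ _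
      _ = ‖S ^ k‖ * ‖S ^ k‖ := by rw [Matrix.l2_opNorm_conjTranspose]
      _ ≤ (r : ℝ) ^ k * (r : ℝ) ^ k := by gcongr
      _ ≤ (r : ℝ) ^ k := by nlinarith
  set P := ∑' k : ℕ, S ^ k * (S ^ k)ᴴ with hPdef
  have hP : P = 1 + S * P * Sᴴ := by
    rw [hPdef, ← hsum.tsum_mul_left, ← (hsum.mul_left S).tsum_mul_right, hsum.tsum_eq_zero_add]
    simp only [pow_zero, Matrix.conjTranspose_one, mul_one, pow_succ', Matrix.conjTranspose_mul,
      mul_assoc]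
  have hpsd : P.PosSemidef := by
    have hherm : P.IsHermitian := by
      have h1 : HasSum (fun k : ℕ => (S ^ k * (S ^ k)ᴴ)ᴴ) Pᴴ := hsum.hasSum.star
      simp only [Matrix.conjTranspose_mul, Matrix.conjTranspose_conjTranspose] at h1
      exact h1.unique hsum.hasSum
    refine Matrix.PosSemidef.of_dotProduct_mulVec_nonneg hherm fun x => ?_
    have hlin : Continuous fun X : Matrix ι ι ℂ => star x ⬝ᵥ X *ᵥ x := by
      unfold dotProduct Matrix.mulVec dotProduct
      exact continuous_finsetSum _ fun i _ => continuous_const.mul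
        (continuous_finsetSum _ fun j _ => (continuous_id.matrix_elem i j).mul continuous_const)
    have h2 := (hlin.tendsto P).comp hsum.hasSum
    refine ge_of_tendsto' h2 fun s => ?_
    exact (Matrix.posSemidef_sum s fun k _ =>
      Matrix.posSemidef_self_mul_conjTranspose (S ^ k)).dotProduct_mulVec_nonneg x
  refine ⟨P, ?_, hP⟩
  rw [hP]
  exact Matrix.PosDef.one.add_posSemidef (hpsd.mul_mul_conjTranspose_same S)

/-- The real part of `(s - 1) / (s + 1)` is `(|s|² - 1) / |s + 1|²`: the Cayley transform exchanges
the left half-plane and the unit disc. -/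
theorem norm_lt_one_of_cayley {s : ℂ} (hs : s + 1 ≠ 0) (h : ((s - 1) / (s + 1)).re < 0) :
    ‖s‖ < 1 := by
  have h1 : 0 < Complex.normSq (s + 1) := Complex.normSq_pos.2 hs
  rw [Complex.div_re, ← add_div, div_lt_iff₀ h1] at h
  simp at h
  rw [← sq_lt_one_iff₀ (norm_nonneg s), ← Complex.normSq_eq_norm_sq, Complex.normSq_apply]
  nlinarith

open scoped ComplexOrder in
/-- Lyapunov's theorem: a Hurwitz matrix satisfies a strict Lyapunov inequality. -/
theorem IsHurwitz.exists_lyapunov {H : Matrix ι ι ℝ} (hH : IsHurwitz H) :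
    ∃ P : Matrix ι ι ℝ, P.PosDef ∧ (-(H * P + P * Hᵀ)).PosDef := by
  set K := cplx H with hK
  -- The continuous-time problem is moved to the discrete one by the Cayley transform `(1 + K)(1 -
  -- K)⁻¹`, which exists because `1` is not an eigenvalue of a Hurwitz matrix.
  have hu : IsUnit (1 - K) := by
    by_contra hcon
    have : (1 : ℂ) ∈ spectrum ℂ K := by
      rw [spectrum.mem_iff]
      simpa using hcon
    have := hH 1 this
    simp at this
    linarith
  have hdet : IsUnit (1 - K).det := (Matrix.isUnit_iff_isUnit_det _).1 hu
  obtain ⟨P, hP, hPe⟩ := exists_posDef_stein (S := (1 + K) * (1 - K)⁻¹) (fun s hs => by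
    rw [mem_spectrum_iff_mulVec] at hs
    obtain ⟨v, hv, hsv⟩ := hs
    set w := (1 - K)⁻¹ *ᵥ v with hw
    have hvw : v = (1 - K) *ᵥ w := by
      rw [hw, Matrix.mulVec_mulVec, Matrix.mul_nonsing_inv _ hdet, Matrix.one_mulVec]
    have hw0 : w ≠ 0 := by
      intro h0
      rw [h0, Matrix.mulVec_zero] at hvw
      exact hv hvw
    rw [← Matrix.mulVec_mulVec, ← hw] at hsv
    rw [hvw] at hsv
    rw [Matrix.add_mulVec, Matrix.sub_mulVec, Matrix.one_mulVec] at hsv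
    have h1 : (s + 1) • K *ᵥ w = (s - 1) • w := by
      rw [smul_sub] at hsv
      rw [add_smul, sub_smul, one_smul, one_smul]
      rw [← sub_eq_zero] at hsv ⊢
      rw [← hsv]; abel
    have hs1 : s + 1 ≠ 0 := by
      intro h0
      rw [h0, zero_smul] at h1
      have h2 := (smul_eq_zero.1 h1.symm).resolve_right hw0
      have h3 : (2 : ℂ) = (s + 1) - (s - 1) := by ring
      rw [h0, h2] at h3
      norm_num at h3
    refine norm_lt_one_of_cayley hs1 ((isHurwitz_iff H).1 hH _ w hw0 ?_)
    rw [div_eq_inv_mul, mul_smul, ← h1, smul_smul, inv_mul_cancel₀ hs1, one_smul])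
  -- Multiplying the Stein equation by `1 - K` and its adjoint clears the inverse; the quadratic
  -- terms `K P Kᴴ` then cancel and leave the Lyapunov expression.
  have hPe' : (1 - K) * P * (1 - K)ᴴ = (1 - K) * (1 - K)ᴴ + (1 + K) * P * (1 + K)ᴴ := by
    have hKS : (1 - K) * ((1 + K) * (1 - K)⁻¹) = 1 + K := by
      rw [← mul_assoc, show (1 - K) * (1 + K) = (1 + K) * (1 - K) by noncomm_ring, mul_assoc,
        Matrix.mul_nonsing_inv _ hdet, mul_one]
    calc (1 - K) * P * (1 - K)ᴴ
        = (1 - K) * (1 + (1 + K) * (1 - K)⁻¹ * P * ((1 + K) * (1 - K)⁻¹)ᴴ) * (1 - K)ᴴ := by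
          rw [← hPe]
      _ = (1 - K) * (1 - K)ᴴ + ((1 - K) * ((1 + K) * (1 - K)⁻¹)) * P *
            ((1 - K) * ((1 + K) * (1 - K)⁻¹))ᴴ := by
          rw [Matrix.conjTranspose_mul (1 - K)]
          noncomm_ring
      _ = _ := by rw [hKS]
  have hneg : (2 : ℂ) • (-(K * P + P * Kᴴ)) = (1 - K) * (1 - K)ᴴ := by
    simp only [Matrix.conjTranspose_sub, Matrix.conjTranspose_add, Matrix.conjTranspose_one] at hPe' ⊢
    rw [← sub_eq_iff_eq_add] at hPe'
    rw [← hPe', two_smul]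
    noncomm_ring
  have hpos : ((1 - K) * (1 - K)ᴴ).PosDef :=
    Matrix.PosDef.mul_conjTranspose_self _ (Matrix.vecMul_injective_of_isUnit hu)
  refine ⟨P.map Complex.re, posDef_map_re hP, ?_⟩
  have hhalf : (-(K * P + P * Kᴴ)).PosDef := by
    have : -(K * P + P * Kᴴ) = (1 / 2 : ℂ) • ((1 - K) * (1 - K)ᴴ) := by
      rw [← hneg, smul_smul]; norm_num
    rw [this]
    exact hpos.smul (by rw [Complex.pos_iff]; norm_num)
  have := posDef_map_re hhalf
  rw [hK, ← cplx_transpose] at this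
  convert this using 1
  rw [← map_re_cplx_mul, ← map_re_mul_cplx]
  ext i j
  simp

end Hurwitz

/-! ### Exponential stability of linear systems -/

section Stability

variable {ι : Type*} [Fintype ι]

theorem norm_toLp_sq (x : ι → ℝ) : ‖WithLp.toLp 2 x‖ ^ 2 = x ⬝ᵥ x := by
  rw [EuclideanSpace.real_norm_sq_eq, dotProduct]
  exact Finset.sum_congr rfl fun i _ => by simp [sq]

/-- A positive definite quadratic form is equivalent to the Euclidean one. -/
theorem exists_bounds_dotProduct_mulVec {N : Matrix ι ι ℝ} (hN : N.PosDef) :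
    ∃ δ > 0, ∃ K > 0, ∀ x : ι → ℝ,
      δ * (x ⬝ᵥ x) ≤ x ⬝ᵥ N *ᵥ x ∧ x ⬝ᵥ N *ᵥ x ≤ K * (x ⬝ᵥ x) := by
  -- In dimension zero the unit sphere is empty and has no extremal points.
  rcases isEmpty_or_nonempty ι with hι | hι
  · exact ⟨1, one_pos, 1, one_pos, fun x => by simp [dotProduct]⟩
  have hcont : Continuous fun v : EuclideanSpace ℝ ι => v.ofLp ⬝ᵥ N *ᵥ v.ofLp := by
    unfold dotProduct Matrix.mulVec dotProduct
    fun_prop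
  have hcomp : IsCompact (Metric.sphere (0 : EuclideanSpace ℝ ι) 1) := isCompact_sphere _ _
  have hne : (Metric.sphere (0 : EuclideanSpace ℝ ι) 1).Nonempty :=
    NormedSpace.sphere_nonempty.2 zero_le_one
  have hpos : ∀ v ∈ Metric.sphere (0 : EuclideanSpace ℝ ι) 1, 0 < v.ofLp ⬝ᵥ N *ᵥ v.ofLp := by
    intro v hv
    have hv0 : v.ofLp ≠ 0 := by
      intro h
      have : v = 0 := by ext i; simpa using congrFun h i
      simp [this] at hv
    simpa using hN.dotProduct_mulVec_pos hv0
  obtain ⟨a, ha, hamin⟩ := hcomp.exists_isMinOn hne hcont.continuousOn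
  obtain ⟨b, hb, hbmax⟩ := hcomp.exists_isMaxOn hne hcont.continuousOn
  refine ⟨_, hpos a ha, _, hpos b hb, fun x => ?_⟩
  by_cases hx : x = 0
  · simp [hx]
  set r := ‖WithLp.toLp 2 x‖ with hr
  have hr0 : 0 < r := by
    rw [hr, norm_pos_iff]
    intro h
    exact hx (by simpa using h)
  have hmem : WithLp.toLp 2 (r⁻¹ • x) ∈ Metric.sphere (0 : EuclideanSpace ℝ ι) 1 := by
    rw [mem_sphere_zero_iff_norm, WithLp.toLp_smul, norm_smul, ← hr, norm_inv, Real.norm_eq_abs,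
      abs_of_pos hr0, inv_mul_cancel₀ hr0.ne']
  have h1 := hamin hmem
  have h2 := hbmax hmem
  simp only [Set.mem_ofPred_eq, Matrix.mulVec_smul, dotProduct_smul, smul_dotProduct,
    smul_eq_mul] at h1 h2
  rw [← norm_toLp_sq, ← hr]
  have h3 : x ⬝ᵥ N *ᵥ x = r⁻¹ * (r⁻¹ * (x ⬝ᵥ N *ᵥ x)) * r ^ 2 := by
    field_simp
  rw [h3]
  exact ⟨mul_le_mul_of_nonneg_right h1 (sq_nonneg r), mul_le_mul_of_nonneg_right h2 (sq_nonneg r)⟩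

theorem hasDerivAt_dotProduct_mulVec (P : Matrix ι ι ℝ) {φ : ℝ → ι → ℝ} {v : ι → ℝ} {t : ℝ}
    (hφ : HasDerivAt φ v t) :
    HasDerivAt (fun s => φ s ⬝ᵥ P *ᵥ φ s) (v ⬝ᵥ P *ᵥ φ t + φ t ⬝ᵥ P *ᵥ v) t := by
  rw [hasDerivAt_pi] at hφ
  unfold dotProduct Matrix.mulVec dotProduct
  rw [← Finset.sum_add_distrib]
  refine HasDerivAt.fun_sum fun i _ => ?_
  exact (hφ i).mul (HasDerivAt.fun_sum fun j _ => (hφ j).const_mul (P i j))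

theorem exists_isForwardSolution_mulVec (G : Matrix ι ι ℝ) (w₀ : ι → ℝ) :
    ∃ φ, φ 0 = w₀ ∧ IsForwardSolution (fun w => G *ᵥ w) φ := by
  let g : (ι → ℝ) →L[ℝ] (ι → ℝ) := G.mulVecLin.toContinuousLinearMap
  refine ⟨fun t => NormedSpace.exp (t • g) w₀, by simp, fun t _ => ?_⟩
  exact ((hasDerivAt_exp_smul_const' (𝕂 := ℝ) g t).clm_apply
    (hasDerivAt_const t w₀)).hasDerivWithinAt.congr_deriv (by simp [g])

/-- Linear systems with a Hurwitz matrix are globally exponentially stable. -/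
theorem IsHurwitz.isGES [DecidableEq ι] {G : Matrix ι ι ℝ} (hG : IsHurwitz G) : IsGES (fun w => G *ᵥ w) := by
  refine ⟨exists_isForwardSolution_mulVec G, ?_⟩
  -- The transpose gives `Gᵀ P + P G`, the form in the derivative of `V = xᵀ P x`.
  obtain ⟨P, hP, hN⟩ := (isHurwitz_transpose.2 hG).exists_lyapunov
  rw [Matrix.transpose_transpose] at hN
  obtain ⟨δ, hδ, K, hK, hPb⟩ := exists_bounds_dotProduct_mulVec hP
  obtain ⟨ε, hε, _, _, hNb⟩ := exists_bounds_dotProduct_mulVec hN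
  -- From `δ |x|² ≤ V ≤ K |x|²` and `V' ≤ -ε |x|²`, `V` decays at rate `ε / K`; taking square roots
  -- halves the rate and gives the constant `√(K / δ)`.
  refine ⟨√(K / δ), Real.sqrt_pos.2 (by positivity), ε / K / 2, by positivity, fun φ hφ t ht => ?_⟩
  set α := ε / K with hα
  have hderiv : ∀ s, 0 < s → HasDerivAt (fun s => Real.exp (α * s) * (φ s ⬝ᵥ P *ᵥ φ s))
      (Real.exp (α * s) * α * (φ s ⬝ᵥ P *ᵥ φ s) +
        Real.exp (α * s) * (G *ᵥ φ s ⬝ᵥ P *ᵥ φ s + φ s ⬝ᵥ P *ᵥ (G *ᵥ φ s))) s := by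
    intro s hs
    have h1 : HasDerivAt (fun r : ℝ => Real.exp (α * r)) (Real.exp (α * s) * α) s := by
      have : HasDerivAt (fun r : ℝ => α * r) α s := by
        simpa using (hasDerivAt_id s).const_mul α
      exact this.exp
    exact h1.mul (hasDerivAt_dotProduct_mulVec P ((hφ s hs.le).hasDerivAt (Ici_mem_nhds hs)))
  have hanti : AntitoneOn (fun s => Real.exp (α * s) * (φ s ⬝ᵥ P *ᵥ φ s)) (Ici 0) := by
    refine antitoneOn_of_deriv_nonpos (convex_Ici 0) ?_ ?_ ?_
    · have hc : ContinuousOn φ (Ici 0) := fun s hs => (hφ s hs).continuousWithinAt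
      have hq : Continuous fun x : ι → ℝ => x ⬝ᵥ P *ᵥ x := by
        unfold dotProduct Matrix.mulVec dotProduct
        fun_prop
      exact (Continuous.continuousOn (by fun_prop)).mul (hq.comp_continuousOn hc)
    · intro s hs
      rw [interior_Ici] at hs
      exact (hderiv s hs).differentiableAt.differentiableWithinAt
    · intro s hs
      rw [interior_Ici] at hs
      rw [(hderiv s hs).deriv]
      have h1 : G *ᵥ φ s ⬝ᵥ P *ᵥ φ s + φ s ⬝ᵥ P *ᵥ (G *ᵥ φ s) =
          -(φ s ⬝ᵥ (-(Gᵀ * P + P * G)) *ᵥ φ s) := by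
        rw [Matrix.neg_mulVec, dotProduct_neg, neg_neg, Matrix.add_mulVec, dotProduct_add,
          ← Matrix.mulVec_mulVec, ← Matrix.mulVec_mulVec, Matrix.dotProduct_mulVec (φ s) Gᵀ,
          Matrix.vecMul_transpose]
      rw [h1]
      have h2 := (hNb (φ s)).1
      have h3 := (hPb (φ s)).2
      have h4 : α * (φ s ⬝ᵥ P *ᵥ φ s) ≤ ε * (φ s ⬝ᵥ φ s) := by
        calc α * (φ s ⬝ᵥ P *ᵥ φ s) ≤ α * (K * (φ s ⬝ᵥ φ s)) := by gcongr
          _ = ε * (φ s ⬝ᵥ φ s) := by rw [hα]; field_simp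
      have h5 := Real.exp_pos (α * s)
      nlinarith
  have hV := hanti (mem_Ici.2 le_rfl) (mem_Ici.2 ht) ht
  simp only [mul_zero, Real.exp_zero, one_mul] at hV
  have h0 := (hPb (φ 0)).2
  have h1 := (hPb (φ t)).1
  rw [← norm_toLp_sq] at h0 h1
  have hE := Real.exp_pos (α * t)
  refine (pow_le_pow_iff_left₀ (norm_nonneg _) (by positivity) two_ne_zero).1 ?_
  rw [mul_pow, mul_pow, Real.sq_sqrt (by positivity), ← Real.exp_nat_mul]
  have h2 : ((2 : ℕ) : ℝ) * (-(α / 2) * t) = -(α * t) := by push_cast; ring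
  rw [h2, Real.exp_neg]
  have h3 : Real.exp (α * t) * (δ * ‖WithLp.toLp 2 (φ t)‖ ^ 2) ≤ K * ‖WithLp.toLp 2 (φ 0)‖ ^ 2 :=
    (mul_le_mul_of_nonneg_left h1 hE.le).trans (hV.trans h0)
  rw [show K / δ * (Real.exp (α * t))⁻¹ * ‖WithLp.toLp 2 (φ 0)‖ ^ 2 =
    K * ‖WithLp.toLp 2 (φ 0)‖ ^ 2 / (Real.exp (α * t) * δ) by field_simp, le_div_iff₀ (by positivity)]
  linarith

end Stability

/-! ### Pole placement by output injection -/

section PolePlacement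

variable {K Y : Type*} [Field K] [AddCommGroup Y] [Module K Y]

/-- If `A - μ` is invertible, take `τ = g C (A - μ)⁻¹` with `g C ≠ 0`; otherwise take `τ` vanishing
on its range and `g = 0`. Once `τ v = 1`, output injection of `g` along `v` makes `τ` a left
eigenvector for `μ`. -/
theorem exists_left_eigenvector_mod_output {V : Type*} [AddCommGroup V] [Module K V]
    [FiniteDimensional K V] (A : Module.End K V) {C : V →ₗ[K] Y} (hC : C ≠ 0) (μ : K) :
    ∃ (τ : V →ₗ[K] K) (g : Y →ₗ[K] K), τ ≠ 0 ∧ τ ∘ₗ (A - μ • 1) = g ∘ₗ C := by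
  by_cases hs : Function.Surjective (A - μ • 1 : Module.End K V)
  · have hi : Function.Injective (A - μ • 1 : Module.End K V) :=
      LinearMap.injective_iff_surjective.2 hs
    let e := LinearEquiv.ofBijective (A - μ • 1 : Module.End K V) ⟨hi, hs⟩
    obtain ⟨v, hv⟩ : ∃ v, C v ≠ 0 := by
      by_contra! h
      exact hC (LinearMap.ext h)
    obtain ⟨g, hg⟩ : ∃ g : Module.Dual K Y, g (C v) ≠ 0 := by
      by_contra! h
      exact hv ((Module.forall_dual_apply_eq_zero_iff K _).1 h)
    refine ⟨g ∘ₗ C ∘ₗ e.symm.toLinearMap, g, fun h => hg ?_, ?_⟩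
    · simpa using LinearMap.congr_fun h (e v)
    · ext x
      have : e.symm ((A - μ • 1 : Module.End K V) x) = x := e.symm_apply_apply x
      simp only [LinearMap.comp_apply, LinearEquiv.coe_coe, this]
  · obtain ⟨τ, hτ, hle⟩ := Submodule.exists_le_ker_of_lt_top
      (LinearMap.range (A - μ • 1 : Module.End K V))
      (lt_top_iff_ne_top.2 fun h => hs (LinearMap.range_eq_top.1 h))
    refine ⟨τ, 0, hτ, ?_⟩
    rw [LinearMap.zero_comp]
    exact LinearMap.range_le_ker_iff.1 hle

/-- If no nonzero invariant subspace is contained in the kernel of the output map, then the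
eigenvalues can be assigned by output injection. -/
theorem exists_outputInjection_hasEigenvalue (d : ℕ) :
    ∀ {V : Type*} [AddCommGroup V] [Module K V] [FiniteDimensional K V]
      (_ : Module.finrank K V = d) (A : Module.End K V) (C : V →ₗ[K] Y)
      (_ : ∀ W : Submodule K V, W ≤ LinearMap.ker C → (∀ w ∈ W, A w ∈ W) → W = ⊥)
      (lam : Fin d → K), ∃ L : Y →ₗ[K] V, ∀ i, Module.End.HasEigenvalue (A - L ∘ₗ C) (lam i) := by
  induction d with
  | zero => exact fun _ _ _ _ _ => ⟨0, fun i => i.elim0⟩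
  | succ d ih =>
    intro V _ _ _ hV A C hobs lam
    have hnt : Nontrivial V := Module.nontrivial_of_finrank_pos (R := K) (by omega)
    have hC : C ≠ 0 := by
      rintro rfl
      exact top_ne_bot (hobs ⊤ (by simp) (by simp))
    obtain ⟨τ, g, hτ, hτg⟩ := exists_left_eigenvector_mod_output A hC (lam 0)
    obtain ⟨v₁, hv₁⟩ : ∃ v, τ v ≠ 0 := by
      by_contra! h
      exact hτ (LinearMap.ext h)
    set v₀ := (τ v₁)⁻¹ • v₁ with hv₀def
    have hv₀ : τ v₀ = 1 := by simp [hv₀def, hv₁]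
    have hτA : ∀ x, τ (A x) = lam 0 * τ x + g (C x) := by
      intro x
      have := LinearMap.congr_fun hτg x
      simp only [LinearMap.comp_apply, LinearMap.sub_apply, map_sub, LinearMap.smul_apply,
        Module.End.one_apply, map_smul, smul_eq_mul] at this
      linear_combination this
    -- After this injection `τ` is a left eigenvector for `lam 0`, so its kernel is an invariant
    -- hyperplane, to which the induction hypothesis applies.
    let A' : Module.End K V := A - g.smulRight v₀ ∘ₗ C
    have hA' : ∀ x, A' x = A x - g (C x) • v₀ := fun x => rfl
    have hτA' : ∀ x, τ (A' x) = lam 0 * τ x := by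
      intro x
      rw [hA', map_sub, map_smul, hv₀, hτA]
      simp
    have hinv : ∀ x ∈ LinearMap.ker τ, A' x ∈ LinearMap.ker τ := by
      intro x hx
      rw [LinearMap.mem_ker] at hx ⊢
      rw [hτA', hx, mul_zero]
    obtain ⟨L', hL'⟩ := ih (V := LinearMap.ker τ)
      (by have := Module.Dual.finrank_ker_add_one_of_ne_zero (f := τ) hτ; omega)
      (A'.restrict hinv) (C ∘ₗ (LinearMap.ker τ).subtype)
      -- Unobservable subspaces are not affected by output injection: `A'` and `A` agree on the
      -- kernel of `C`.
      (fun W hW hWA => by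
        have h1 : W.map (LinearMap.ker τ).subtype = ⊥ := by
          refine hobs _ ?_ ?_
          · rintro _ ⟨w, hw, rfl⟩
            exact hW hw
          · rintro _ ⟨w, hw, rfl⟩
            refine ⟨_, hWA w hw, ?_⟩
            have : C w = 0 := hW hw
            simp [hA', this]
        exact Submodule.map_injective_of_injective (Submodule.injective_subtype _)
          (h1.trans (Submodule.map_bot _).symm))
      (fun i => lam i.succ)
    refine ⟨g.smulRight v₀ + (LinearMap.ker τ).subtype ∘ₗ L', fun i => ?_⟩
    set A'' := A - (g.smulRight v₀ + (LinearMap.ker τ).subtype ∘ₗ L') ∘ₗ C with hA''def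
    have hA'' : ∀ x, A'' x = A' x - L' (C x) := by
      intro x
      simp [hA''def, hA', sub_sub]
    refine Fin.cases ?_ (fun i => ?_) i
    -- The second injection takes values in the kernel of `τ`, so `τ` remains a left eigenvector.
    -- Hence `A'' - lam 0` cannot be onto: `τ` kills its range but not `v₀`.
    · by_contra hne
      rw [Module.End.HasEigenvalue, Module.End.HasUnifEigenvalue, not_not] at hne
      have hker : LinearMap.ker (A'' - lam 0 • 1) = ⊥ := by
        rw [← hne]
        ext x
        rw [Module.End.mem_eigenspace_iff]
        simp [sub_eq_zero]
      have hsurj := LinearMap.injective_iff_surjective.1 (LinearMap.ker_eq_bot.1 hker)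
      obtain ⟨x, hx⟩ := hsurj v₀
      have h1 : τ ((A'' - lam 0 • 1) x) = 0 := by
        have h2 : τ (L' (C x)) = 0 := (L' (C x)).2
        simp [hA'', hτA', h2]
      rw [hx, hv₀] at h1
      exact one_ne_zero h1
    · obtain ⟨w, hw⟩ := (hL' i).exists_hasEigenvector
      refine Module.End.hasEigenvalue_of_hasEigenvector (x := (w : V))
        ⟨Module.End.mem_eigenspace_iff.2 ?_, by simpa using hw.2⟩
      have := congrArg Subtype.val hw.apply_eq_smul
      simpa [hA''] using this

variable {n m p : ℕ}

/-- Every `C A ^ k` vanishes on such a `W`, which therefore lies in the kernel of the observability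
matrix. -/
theorem IsObservable.eq_bot_of_le_ker {A : Matrix (Fin n) (Fin n) ℝ} {C : Matrix (Fin p) (Fin n) ℝ}
    (h : IsObservable C A) (W : Submodule ℝ (Fin n → ℝ)) (hW : W ≤ LinearMap.ker (toLin' C))
    (hWA : ∀ w ∈ W, toLin' A w ∈ W) : W = ⊥ := by
  rw [eq_bot_iff]
  intro w hw
  have hpow : ∀ k : ℕ, A ^ k *ᵥ w ∈ W := by
    intro k
    induction k with
    | zero => simpa using hw
    | succ k ih =>
      rw [pow_succ', ← Matrix.mulVec_mulVec]
      simpa using hWA _ ih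
  have h0 : obsMatrix C A *ᵥ w = 0 := by
    ext ki
    have h1 : C *ᵥ (A ^ (ki.1 : ℕ) *ᵥ w) = 0 := by simpa using hW (hpow ki.1)
    rw [Matrix.mulVec_mulVec] at h1
    exact congrFun h1 ki.2
  have hrank := (obsMatrix C A).mulVecLin.finrank_range_add_finrank_ker
  have h2 : Module.finrank ℝ (LinearMap.range (obsMatrix C A).mulVecLin) = Fintype.card (Fin n) := h
  rw [h2, Module.finrank_pi] at hrank
  have h3 : LinearMap.ker (obsMatrix C A).mulVecLin = ⊥ := Submodule.finrank_eq_zero.1 (by omega)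
  have h4 : w ∈ LinearMap.ker (obsMatrix C A).mulVecLin := h0
  rwa [h3] at h4

theorem IsObservable.exists_hasEigenvalue {A : Matrix (Fin n) (Fin n) ℝ}
    {C : Matrix (Fin p) (Fin n) ℝ} (h : IsObservable C A) (lam : Fin n → ℝ) :
    ∃ L : Matrix (Fin n) (Fin p) ℝ,
      ∀ i, Module.End.HasEigenvalue (toLin' (A - L * C)) (lam i) := by
  obtain ⟨L, hL⟩ := exists_outputInjection_hasEigenvalue n (by simp) (toLin' A) (toLin' C)
    h.eq_bot_of_le_ker lam
  refine ⟨LinearMap.toMatrix' L, fun i => ?_⟩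
  have := hL i
  rwa [map_sub, Matrix.toLin'_mul, Matrix.toLin'_toMatrix']

theorem isObservable_transpose {A : Matrix (Fin n) (Fin n) ℝ} {B : Matrix (Fin n) (Fin m) ℝ}
    (h : IsControllable A B) : IsObservable Bᵀ Aᵀ := by
  have : obsMatrix Bᵀ Aᵀ = (reachMatrix A B)ᵀ := by
    ext ki j
    simp only [obsMatrix, reachMatrix, Matrix.of_apply, Matrix.transpose_apply]
    rw [← Matrix.transpose_pow, ← Matrix.transpose_mul, Matrix.transpose_apply]
  rw [IsObservable, this, Matrix.rank_transpose]
  exact h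

theorem exists_mul_eq_mul_diagonal {A : Matrix (Fin n) (Fin n) ℝ} {lam : Fin n → ℝ}
    (hlam : Function.Injective lam) (h : ∀ i, Module.End.HasEigenvalue (toLin' A) (lam i)) :
    ∃ V : Matrix (Fin n) (Fin n) ℝ, IsUnit V.det ∧ A * V = V * Matrix.diagonal lam := by
  choose v hv using fun i => (h i).exists_hasEigenvector
  have hli : LinearIndependent ℝ v := Module.End.eigenvectors_linearIndependent' _ lam hlam v hv
  refine ⟨(Matrix.of v)ᵀ, ?_, ?_⟩
  · rw [← Matrix.isUnit_iff_isUnit_det, ← Matrix.linearIndependent_cols_iff_isUnit]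
    exact hli
  · ext i j
    have := congrFun (hv j).apply_eq_smul i
    rw [Matrix.toLin'_apply] at this
    rw [Matrix.mul_diagonal]
    simpa [Matrix.mulVec, dotProduct, Matrix.mul_apply, mul_comm] using this

/-- Two matrices with the same `n` distinct eigenvalues are similar. -/
theorem exists_eq_conj_of_hasEigenvalue {A F : Matrix (Fin n) (Fin n) ℝ} {lam : Fin n → ℝ}
    (hlam : Function.Injective lam) (hA : ∀ i, Module.End.HasEigenvalue (toLin' A) (lam i))
    (hF : ∀ i, Module.End.HasEigenvalue (toLin' F) (lam i)) :
    ∃ T : Matrix (Fin n) (Fin n) ℝ, IsUnit T.det ∧ F = T * A * T⁻¹ := by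
  obtain ⟨V, hV, hAV⟩ := exists_mul_eq_mul_diagonal hlam hA
  obtain ⟨W, hW, hFW⟩ := exists_mul_eq_mul_diagonal hlam hF
  refine ⟨W * V⁻¹, ?_, ?_⟩
  · rw [Matrix.det_mul]
    exact hW.mul ((Matrix.isUnit_nonsing_inv_det_iff).2 hV)
  · rw [Matrix.mul_inv_rev, Matrix.nonsing_inv_nonsing_inv _ hV]
    calc F = F * W * W⁻¹ := (Matrix.mul_nonsing_inv_cancel_right _ _ hW).symm
      _ = W * Matrix.diagonal lam * W⁻¹ := by rw [hFW]
      _ = W * (V⁻¹ * (V * Matrix.diagonal lam)) * W⁻¹ := by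
        rw [Matrix.nonsing_inv_mul_cancel_left _ _ hV]
      _ = W * V⁻¹ * A * (V * W⁻¹) := by rw [← hAV]; simp only [Matrix.mul_assoc]

theorem IsHurwitz.of_similar {A F T : Matrix (Fin n) (Fin n) ℝ} (hF : IsHurwitz F)
    (hT : IsUnit T.det) (h : F = T * A * T⁻¹) : IsHurwitz A := by
  have := hF.conj (P := T⁻¹) (R := T) (Matrix.nonsing_inv_mul _ hT) (Matrix.mul_nonsing_inv _ hT)
  rwa [h, Matrix.mul_assoc, Matrix.nonsing_inv_mul_cancel_right _ _ hT,
    Matrix.nonsing_inv_mul_cancel_left _ _ hT] at this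

/-- A controllable pair is stabilizable. -/
theorem IsControllable.exists_isHurwitz {A F : Matrix (Fin n) (Fin n) ℝ}
    {B : Matrix (Fin n) (Fin m) ℝ} (h : IsControllable A B) {lam : Fin n → ℝ}
    (hlam : Function.Injective lam) (hF : IsHurwitz F)
    (heig : ∀ i, Module.End.HasEigenvalue (toLin' F) (lam i)) :
    ∃ K : Matrix (Fin m) (Fin n) ℝ, IsHurwitz (A + B * K) := by
  -- The eigenvalues of `F` serve as targets: being distinct, they make the dual closed loop similar
  -- to `F`, hence Hurwitz.
  obtain ⟨L, hL⟩ := (isObservable_transpose h).exists_hasEigenvalue lam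
  obtain ⟨T, hT, hTF⟩ := exists_eq_conj_of_hasEigenvalue hlam hL heig
  refine ⟨-Lᵀ, ?_⟩
  rw [← isHurwitz_transpose]
  have := hF.of_similar hT hTF
  simpa [sub_eq_add_neg] using this

end PolePlacement

/-! ### Algebra of the filter -/

section FilterAlgebra

variable {n m p : ℕ}

theorem rowKron_apply {α β γ : Type*} (v : α → ℝ) (S : Matrix β γ ℝ) (i : β) (a : α) (c : γ) :
    rowKron v S i (a, c) = v a * S i c := rfl

theorem rowKron_mulVec_vec {α β γ : Type*} [Fintype α] [Fintype γ] (v : α → ℝ) (S : Matrix β γ ℝ)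
    (M : Matrix γ α ℝ) : rowKron v S *ᵥ Matrix.vec M = S *ᵥ (M *ᵥ v) := by
  ext i
  simp only [Matrix.mulVec, dotProduct, Fintype.sum_prod_type, rowKron_apply, Matrix.vec,
    Finset.mul_sum]
  rw [Finset.sum_comm]
  exact Finset.sum_congr rfl fun c _ => Finset.sum_congr rfl fun a _ => by ring

theorem mul_rowKron {α β γ δ : Type*} [Fintype β] (v : α → ℝ) (R : Matrix δ β ℝ)
    (S : Matrix β γ ℝ) : R * rowKron v S = rowKron v (R * S) := by
  ext i ⟨a, c⟩
  simp only [Matrix.mul_apply, rowKron_apply, Finset.mul_sum]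
  exact Finset.sum_congr rfl fun b _ => by ring

theorem Fxi_mulVec_vec (F : Matrix (Fin n) (Fin n) ℝ) (M : Matrix (Fin n) (MuIdx n m p) ℝ) :
    Fxi m p F *ᵥ Matrix.vec M = Matrix.vec (F * M) :=
  (Matrix.vec_mul_eq_mulVec F M).symm

theorem filterInput_mulVec_theta (B : Matrix (Fin n) (Fin m) ℝ) (T : Matrix (Fin n) (Fin n) ℝ)
    (L : Matrix (Fin n) (Fin p) ℝ) (y : Fin p → ℝ) (u : Fin m → ℝ) :
    filterInput n y u *ᵥ theta B T L = T *ᵥ (L *ᵥ y + B *ᵥ u) := by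
  rw [filterInput, theta, Matrix.fromCols_mulVec_sumElim, rowKron_mulVec_vec, rowKron_mulVec_vec,
    Matrix.one_mulVec, Matrix.one_mulVec, Matrix.mulVec_add, Matrix.mulVec_mulVec,
    Matrix.mulVec_mulVec]

theorem vec_filterInput (y : Fin p → ℝ) (u : Fin m → ℝ) :
    Matrix.vec (filterInput n y u) = Lxi n m p *ᵥ y + Bxi n m p *ᵥ u := by
  ext ⟨c, i⟩
  rcases c with ⟨j, k⟩ | ⟨j, k⟩
  · simp [Matrix.vec, filterInput, rowKron_apply, Matrix.mulVec, dotProduct, Lxi, Bxi,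
      Matrix.one_apply, mul_comm]
  · simp [Matrix.vec, filterInput, rowKron_apply, Matrix.mulVec, dotProduct, Lxi, Bxi,
      Matrix.one_apply, mul_comm]

theorem vec_filterRHS (F : Matrix (Fin n) (Fin n) ℝ) (M : Matrix (Fin n) (MuIdx n m p) ℝ)
    (y : Fin p → ℝ) (u : Fin m → ℝ) :
    Matrix.vec (filterRHS F M y u) =
      Fxi m p F *ᵥ Matrix.vec M + (Lxi n m p *ᵥ y + Bxi n m p *ᵥ u) := by
  rw [filterRHS, Matrix.vec_add, vec_filterInput, Fxi_mulVec_vec]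

theorem exists_vec_eq {α β : Type*} (ξ : β × α → ℝ) : ∃ M : Matrix α β ℝ, Matrix.vec M = ξ :=
  Matrix.vec_bijective.2 ξ

variable {A : Matrix (Fin n) (Fin n) ℝ} {B : Matrix (Fin n) (Fin m) ℝ}
  {C : Matrix (Fin p) (Fin n) ℝ} {F T : Matrix (Fin n) (Fin n) ℝ} {L : Matrix (Fin n) (Fin p) ℝ}

/-- The vector `L_ξ y` is the vectorized filter input for `u = 0`, and multiplying that input by `θ`
gives `T L y`. -/
theorem rowKron_theta_mul_Lxi (hT : IsUnit T.det) :
    rowKron (theta B T L) T⁻¹ * Lxi n m p = L := by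
  refine Matrix.ext_of_mulVec_single fun j => ?_
  rw [← Matrix.mulVec_mulVec]
  have := vec_filterInput (n := n) (Pi.single j 1 : Fin p → ℝ) (0 : Fin m → ℝ)
  rw [Matrix.mulVec_zero, add_zero] at this
  rw [← this, rowKron_mulVec_vec, filterInput_mulVec_theta, Matrix.mulVec_mulVec,
    Matrix.nonsing_inv_mul _ hT, Matrix.one_mulVec, Matrix.mulVec_zero, add_zero]

theorem rowKron_theta_mul_Bxi (hT : IsUnit T.det) :
    rowKron (theta B T L) T⁻¹ * Bxi n m p = B := by
  refine Matrix.ext_of_mulVec_single fun j => ?_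
  rw [← Matrix.mulVec_mulVec]
  have := vec_filterInput (n := n) (0 : Fin p → ℝ) (Pi.single j 1 : Fin m → ℝ)
  rw [Matrix.mulVec_zero, zero_add] at this
  rw [← this, rowKron_mulVec_vec, filterInput_mulVec_theta, Matrix.mulVec_mulVec,
    Matrix.nonsing_inv_mul _ hT, Matrix.one_mulVec, Matrix.mulVec_zero, zero_add]

theorem inv_mul_eq_of_similar (hT : IsUnit T.det) (h : F = T * (A - L * C) * T⁻¹) :
    T⁻¹ * F = (A - L * C) * T⁻¹ := by
  rw [h, Matrix.mul_assoc, Matrix.nonsing_inv_mul_cancel_left _ _ hT]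

theorem rowKron_theta_mul_Fxi (hT : IsUnit T.det) (h : F = T * (A - L * C) * T⁻¹) :
    rowKron (theta B T L) T⁻¹ * Fxi m p F = (A - L * C) * rowKron (theta B T L) T⁻¹ := by
  rw [mul_rowKron, ← inv_mul_eq_of_similar hT h]
  refine Matrix.ext_of_mulVec_single fun j => ?_
  obtain ⟨M, hM⟩ := exists_vec_eq (Pi.single j 1 : XiIdx n m p → ℝ)
  rw [← Matrix.mulVec_mulVec, ← hM, Fxi_mulVec_vec, rowKron_mulVec_vec, rowKron_mulVec_vec,
    ← Matrix.mulVec_mulVec, ← Matrix.mulVec_mulVec]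

/-- The map `ξ ↦ T⁻¹ M θ` intertwines the non-minimal realization and the plant. -/
theorem rowKron_theta_mul_Axi (hT : IsUnit T.det) (h : F = T * (A - L * C) * T⁻¹) :
    rowKron (theta B T L) T⁻¹ * Axi B C F T L = A * rowKron (theta B T L) T⁻¹ := by
  rw [Axi, Matrix.mul_add, rowKron_theta_mul_Fxi hT h, ← Matrix.mul_assoc,
    rowKron_theta_mul_Lxi hT, Cxi, ← Matrix.mul_assoc, ← Matrix.add_mul, sub_add_cancel]

/-- Some block of an eigenvector of `I ⊗ F` is nonzero, and it is an eigenvector of `F`. -/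
theorem isHurwitz_Fxi (hF : IsHurwitz F) : IsHurwitz (Fxi m p F) := by
  rw [isHurwitz_iff] at hF ⊢
  intro s v hv h
  obtain ⟨⟨c, i⟩, hci⟩ := Function.ne_iff.1 hv
  refine hF s (fun i => v (c, i)) (fun h0 => hci (congrFun h0 i)) ?_
  ext i
  have := congrFun h (c, i)
  simpa [cplx, Fxi, Matrix.mulVec, dotProduct, Fintype.sum_prod_type, Matrix.one_apply,
    ite_mul, apply_ite] using this

/-- The non-minimal realization is stabilizable if the plant is. -/
theorem isHurwitz_Axi_add (hT : IsUnit T.det) (h : F = T * (A - L * C) * T⁻¹) (hF : IsHurwitz F)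
    {K : Matrix (Fin m) (Fin n) ℝ} (hK : IsHurwitz (A + B * K)) :
    IsHurwitz (Axi B C F T L + Bxi n m p * (K * rowKron (theta B T L) T⁻¹)) := by
  have hFξ : IsHurwitz (Fxi m p F) := isHurwitz_Fxi hF
  set R := rowKron (theta B T L) T⁻¹ with hR
  have hint : R * (Axi B C F T L + Bxi n m p * (K * R)) = (A + B * K) * R := by
    rw [Matrix.mul_add, hR, rowKron_theta_mul_Axi hT h, ← Matrix.mul_assoc,
      rowKron_theta_mul_Bxi hT, Matrix.add_mul, Matrix.mul_assoc]
  rw [isHurwitz_iff] at hK hFξ ⊢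
  intro s v hv hs
  -- An eigenvector is either mapped by `R` to an eigenvector of `A + B K`, or killed by `R`; in the
  -- latter case both feedback terms vanish on it and it is an eigenvector of `F_ξ`.
  by_cases hw : cplx R *ᵥ v = 0
  · refine hFξ s v hv ?_
    have hker : Axi B C F T L + Bxi n m p * (K * R) =
        Fxi m p F + (Lxi n m p * C + Bxi n m p * K) * R := by
      rw [Axi, Cxi, ← hR, Matrix.add_mul, add_assoc]
      simp only [Matrix.mul_assoc]
    rw [hker, cplx_add, cplx_mul, Matrix.add_mulVec, ← Matrix.mulVec_mulVec, hw,
      Matrix.mulVec_zero, add_zero] at hs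
    exact hs
  · refine hK s _ hw ?_
    rw [Matrix.mulVec_mulVec, ← cplx_mul, ← hint, cplx_mul, ← Matrix.mulVec_mulVec, hs,
      Matrix.mulVec_smul]

/-- The interconnection of the plant with the filter is Hurwitz. -/
theorem isHurwitz_interconnection (hT : IsUnit T.det) (h : F = T * (A - L * C) * T⁻¹)
    (hF : IsHurwitz F) {K : Matrix (Fin m) (XiIdx n m p) ℝ}
    (hK : IsHurwitz (Axi B C F T L + Bxi n m p * K)) :
    IsHurwitz (Matrix.fromBlocks A (B * K) (Lxi n m p * C) (Fxi m p F + Bxi n m p * K)) := by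
  have hAL : IsHurwitz (A - L * C) := hF.of_similar hT h
  set R : Matrix (Fin n) (XiIdx n m p) ℝ := rowKron (theta B T L) T⁻¹ with hR
  -- In the coordinates `e = x - R ξ` and `ξ`, the error obeys `e' = (A - L C) e` and drives `ξ`
  -- through `L_ξ C e`.
  have hconj : Matrix.fromBlocks 1 R 0 1 *
      Matrix.fromBlocks (A - L * C) 0 (Lxi n m p * C) (Axi B C F T L + Bxi n m p * K) *
      Matrix.fromBlocks 1 (-R) 0 1 =
      Matrix.fromBlocks A (B * K) (Lxi n m p * C) (Fxi m p F + Bxi n m p * K) := by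
    have h1 : R * (Lxi n m p * C) = L * C := by
      rw [← Matrix.mul_assoc, hR, rowKron_theta_mul_Lxi hT]
    have h2 : R * (Axi B C F T L + Bxi n m p * K) = A * R + B * K := by
      rw [Matrix.mul_add, hR, rowKron_theta_mul_Axi hT h, ← Matrix.mul_assoc,
        rowKron_theta_mul_Bxi hT]
    have h3 : Axi B C F T L = Fxi m p F + Lxi n m p * C * R := by
      rw [Axi, Cxi, hR, Matrix.mul_assoc]
    simp only [Matrix.fromBlocks_multiply, Matrix.one_mul, Matrix.mul_one, Matrix.zero_mul,
      Matrix.mul_zero, zero_add, add_zero, h1, h2, Matrix.mul_neg, sub_add_cancel]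
    rw [h3]
    congr 1 <;> abel
  rw [← hconj]
  refine (isHurwitz_fromBlocks_zero₁₂.2 ⟨hAL, hK⟩).conj ?_ ?_ <;>
  simp [Matrix.fromBlocks_multiply, Matrix.fromBlocks_one]

/-- A gain whose restriction to `ξ` stabilizes the non-minimal realization gives a stabilizing
filter-based controller. -/
theorem filterControllerStabilizes_of_isHurwitz (hT : IsUnit T.det)
    (h : F = T * (A - L * C) * T⁻¹) (hF : IsHurwitz F) {Ke : Matrix (Fin m) (ZIdx n m p) ℝ}
    (hK : IsHurwitz (Axi B C F T L + Bxi n m p * Ke.toCols₂)) :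
    FilterControllerStabilizes A B C F Ke := by
  have hu : ∀ ξ : XiIdx n m p → ℝ, Ke *ᵥ Sum.elim 0 ξ = Ke.toCols₂ *ᵥ ξ := by
    intro ξ
    conv_lhs => rw [← Matrix.fromCols_toCols Ke]
    rw [Matrix.fromCols_mulVec_sumElim, Matrix.mulVec_zero, zero_add]
  refine ⟨Fxi m p F + Bxi n m p * Ke.toCols₂, Lxi n m p, Ke.toCols₂, 0, ?_, ?_⟩
  · intro M y
    rw [hu, Matrix.zero_mulVec, add_zero, vec_filterRHS, Matrix.add_mulVec, Matrix.mulVec_mulVec]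
    exact ⟨rfl, by abel⟩
  · have := (isHurwitz_interconnection hT h hF hK).isGES
    convert this using 2 with w
    rw [Matrix.fromBlocks_mulVec]
    ext (i | i)
    · simp [closedLoop, Matrix.mulVec_mulVec, Function.comp_def]
    · simp [closedLoop, Matrix.mulVec_mulVec, Function.comp_def, add_comm]

end FilterAlgebra

/-! ### Signals -/

section Signals

theorem IsACSolution.continuousOn {ι : Type*} {τ : ℝ} (hτ : 0 ≤ τ) {f g : ℝ → ι → ℝ}
    (h : IsACSolution 0 τ f g) : ContinuousOn f (Icc 0 τ) := by
  rw [continuousOn_pi]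
  intro i
  have := (h i).1.continuousOn
  rwa [uIcc_of_le hτ] at this

theorem absolutelyContinuousOnInterval_zero (a b : ℝ) :
    AbsolutelyContinuousOnInterval (fun _ => (0 : ℝ)) a b :=
  contDiff_const.contDiffOn.absolutelyContinuousOnInterval

theorem IsACSolution.dotProduct {ι : Type*} [Fintype ι] {a b : ℝ} {f g : ℝ → ι → ℝ}
    (h : IsACSolution a b f g) (c : ι → ℝ) :
    AbsolutelyContinuousOnInterval (fun t => c ⬝ᵥ f t) a b ∧
      ∀ᵐ t ∂(volume.restrict (Icc a b)), HasDerivAt (fun s => c ⬝ᵥ f s) (c ⬝ᵥ g t) t := by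
  constructor
  · unfold _root_.dotProduct
    induction (Finset.univ : Finset ι) using Finset.cons_induction with
    | empty => simpa using absolutelyContinuousOnInterval_zero a b
    | cons i s hi ih =>
      simp only [Finset.sum_cons]
      exact ((h i).1.const_mul (c i)).fun_add ih
  · filter_upwards [ae_all_iff.2 fun i => (h i).2] with t ht
    exact HasDerivAt.fun_sum fun i _ => (ht i).const_mul (c i)

/-- An absolutely continuous solution of `f' = r f` is an exponential. -/
theorem eq_mul_exp_of_ae_hasDerivAt {f : ℝ → ℝ} {τ r : ℝ} (hτ : 0 ≤ τ)
    (hf : AbsolutelyContinuousOnInterval f 0 τ)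
    (hd : ∀ᵐ t ∂(volume.restrict (Icc 0 τ)), HasDerivAt f (r * f t) t) :
    ∀ t ∈ Icc 0 τ, f t = f 0 * Real.exp (r * t) := by
  have he : AbsolutelyContinuousOnInterval (fun t => Real.exp (-(r * t))) 0 τ :=
    ContDiffOn.absolutelyContinuousOnInterval (ContDiff.contDiffOn (by fun_prop))
  -- The product `f(t) exp(-r t)` is absolutely continuous with derivative zero almost everywhere,
  -- hence constant.
  obtain ⟨c, hc⟩ := (hf.fun_mul he).const_of_ae_hasDerivAt_zero (by
    rw [ae_restrict_iff' measurableSet_Icc] at hd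
    filter_upwards [hd] with t ht hmem
    rw [uIcc_of_le hτ] at hmem
    have h1 : HasDerivAt (fun s : ℝ => -(r * s)) (-r) t := by
      exact (((hasDerivAt_id t).const_mul r).congr_deriv (mul_one r)).fun_neg
    exact ((ht hmem).mul h1.exp).congr_deriv (by ring))
  rw [uIcc_of_le hτ] at hc
  intro t ht
  have h0 := hc 0 ⟨le_rfl, hτ⟩
  have h1 := hc t ht
  simp only [mul_zero, neg_zero, Real.exp_zero, mul_one] at h0
  rw [Real.exp_neg] at h1
  rw [h0, ← h1]
  field_simp

variable {n m p : ℕ} {A : Matrix (Fin n) (Fin n) ℝ} {B : Matrix (Fin n) (Fin m) ℝ}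
  {C : Matrix (Fin p) (Fin n) ℝ} {F : Matrix (Fin n) (Fin n) ℝ} {lam : Fin n → ℝ} {tD : ℝ}
  {u : ℝ → Fin m → ℝ} {x : ℝ → Fin n → ℝ} {y : ℝ → Fin p → ℝ}
  {M : ℝ → Matrix (Fin n) (MuIdx n m p) ℝ}

/-- The transverse coordinate `T x - M θ` is a combination of the exponentials in `χ`. -/
theorem exists_transverse (hlam : Function.Injective lam)
    (heig : ∀ i, Module.End.HasEigenvalue (Matrix.toLin' F) (lam i)) (htD : 0 ≤ tD)
    (hx : IsACSolution 0 tD x (fun t => A *ᵥ x t + B *ᵥ u t))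
    (hy : ∀ t ∈ Icc 0 tD, y t = C *ᵥ x t)
    (hM : IsACSolution 0 tD (fun t => Matrix.vec (M t))
      (fun t => Matrix.vec (filterRHS F (M t) (y t) (u t))))
    {T : Matrix (Fin n) (Fin n) ℝ} {L : Matrix (Fin n) (Fin p) ℝ} (hT : IsUnit T.det)
    (hsim : F = T * (A - L * C) * T⁻¹) :
    ∃ Γ : Matrix (Fin n) (Fin n) ℝ, ∀ t ∈ Icc 0 tD,
      T *ᵥ x t - M t *ᵥ theta B T L = Γ *ᵥ chi lam t := by
  obtain ⟨W, hW, hFW⟩ := exists_mul_eq_mul_diagonal hlam heig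
  have hWF : W⁻¹ * F = Matrix.diagonal lam * W⁻¹ := by
    calc W⁻¹ * F = W⁻¹ * (F * W) * W⁻¹ := by
          rw [Matrix.mul_assoc, Matrix.mul_assoc, Matrix.mul_nonsing_inv _ hW, Matrix.mul_one]
      _ = _ := by rw [hFW, Matrix.nonsing_inv_mul_cancel_left _ _ hW]
  have hFT : T * (A - L * C) = F * T := by
    rw [hsim, Matrix.nonsing_inv_mul_cancel_right _ _ hT]
  set β : ℝ → Fin n → ℝ := fun t => T *ᵥ x t - M t *ᵥ theta B T L with hβ
  have hsplit : ∀ (i : Fin n) (v : Fin n → ℝ) (N : Matrix (Fin n) (MuIdx n m p) ℝ),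
      (W⁻¹ * T) i ⬝ᵥ v - (rowKron (theta B T L) W⁻¹) i ⬝ᵥ Matrix.vec N =
        (W⁻¹ *ᵥ (T *ᵥ v - N *ᵥ theta B T L)) i := by
    intro i v N
    rw [Matrix.mulVec_sub, Matrix.mulVec_mulVec, ← rowKron_mulVec_vec]
    rfl
  -- This is `β' = F β`: the input terms `T B u` cancel, and `T L y` turns `T A x` into `F T x`.
  have hrhs : ∀ t ∈ Icc 0 tD, T *ᵥ (A *ᵥ x t + B *ᵥ u t) -
      filterRHS F (M t) (y t) (u t) *ᵥ theta B T L = F *ᵥ β t := by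
    intro t ht
    rw [filterRHS, Matrix.add_mulVec, filterInput_mulVec_theta, hy t ht]
    simp only [hβ]
    rw [Matrix.mulVec_sub, Matrix.mulVec_mulVec (x t) F T, ← hFT]
    simp only [Matrix.mulVec_add, Matrix.mulVec_mulVec, Matrix.mul_sub, Matrix.sub_mulVec]
    abel
  have hγ : ∀ i, ∀ t ∈ Icc 0 tD, (W⁻¹ *ᵥ β t) i = (W⁻¹ *ᵥ β 0) i * Real.exp (lam i * t) := by
    intro i
    have h1 := hx.dotProduct ((W⁻¹ * T) i)
    have h2 := hM.dotProduct ((rowKron (theta B T L) W⁻¹) i)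
    refine eq_mul_exp_of_ae_hasDerivAt (f := fun t => (W⁻¹ *ᵥ β t) i) htD ?_ ?_
    · have := h1.1.fun_sub h2.1
      simpa only [hsplit] using this
    · filter_upwards [h1.2, h2.2, ae_restrict_mem measurableSet_Icc] with t ht1 ht2 hmem
      have := ht1.fun_sub ht2
      simp only [hsplit] at this
      rw [hrhs t hmem, Matrix.mulVec_mulVec, hWF, ← Matrix.mulVec_mulVec,
        Matrix.mulVec_diagonal] at this
      exact this
  -- From `β(t) = W exp(Λ t) W⁻¹ β(0)`, with the roles of the two diagonal factors exchanged.
  refine ⟨W * Matrix.diagonal (W⁻¹ *ᵥ β 0), fun t ht => ?_⟩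
  have h1 : Matrix.diagonal (W⁻¹ *ᵥ β 0) *ᵥ chi lam t = W⁻¹ *ᵥ β t := by
    ext i
    rw [Matrix.mulVec_diagonal, hγ i t ht, chi]
  rw [← Matrix.mulVec_mulVec, h1, Matrix.mulVec_mulVec, Matrix.mul_nonsing_inv _ hW,
    Matrix.one_mulVec]

theorem exists_isAdmissible (hCA : IsObservable C A) (hlam : Function.Injective lam)
    (heig : ∀ i, Module.End.HasEigenvalue (Matrix.toLin' F) (lam i)) (htD : 0 ≤ tD)
    (hx : IsACSolution 0 tD x (fun t => A *ᵥ x t + B *ᵥ u t))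
    (hy : ∀ t ∈ Icc 0 tD, y t = C *ᵥ x t)
    (hM : IsACSolution 0 tD (fun t => Matrix.vec (M t))
      (fun t => Matrix.vec (filterRHS F (M t) (y t) (u t)))) :
    ∃ T L Γ, IsAdmissible A B C F lam tD x M T L Γ := by
  obtain ⟨L, hL⟩ := hCA.exists_hasEigenvalue lam
  obtain ⟨T, hT, hsim⟩ := exists_eq_conj_of_hasEigenvalue hlam hL heig
  obtain ⟨Γ, hΓ⟩ := exists_transverse hlam heig htD hx hy hM hT hsim
  exact ⟨T, L, Γ, hT, hsim, hΓ⟩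

/-- The available derivative of `z` satisfies the equation of the extended system. -/
theorem zDot_eq {T : Matrix (Fin n) (Fin n) ℝ} {L : Matrix (Fin n) (Fin p) ℝ}
    {Γ : Matrix (Fin n) (Fin n) ℝ} (hadm : IsAdmissible A B C F lam tD x M T L Γ)
    (hy : ∀ t ∈ Icc 0 tD, y t = C *ᵥ x t) {t : ℝ} (ht : t ∈ Icc 0 tD) :
    zDot F lam M y u t = Ae B C F lam T L Γ *ᵥ zSig lam M t + Be n m p *ᵥ u t := by
  have hxt : x t = T⁻¹ *ᵥ (Γ *ᵥ chi lam t) + T⁻¹ *ᵥ (M t *ᵥ theta B T L) := by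
    rw [← hadm.transverse t ht, ← Matrix.mulVec_add, sub_add_cancel, Matrix.mulVec_mulVec,
      Matrix.nonsing_inv_mul _ hadm.nonsing, Matrix.one_mulVec]
  have h1 : Matrix.vec (filterRHS F (M t) (y t) (u t)) =
      (Lxi n m p * C * T⁻¹ * Γ) *ᵥ chi lam t + Axi B C F T L *ᵥ Matrix.vec (M t) +
        Bxi n m p *ᵥ u t := by
    rw [vec_filterRHS, hy t ht, hxt, ← rowKron_mulVec_vec (theta B T L), Axi, Cxi, Matrix.add_mulVec]
    simp only [Matrix.mulVec_add, ← Matrix.mulVec_mulVec]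
    abel
  rw [zDot, h1, Ae, zSig, Matrix.fromBlocks_mulVec, Be, Matrix.fromRows_mulVec]
  ext (i | i) <;> simp

theorem isACSolution_zSig (hM : IsACSolution 0 tD (fun t => Matrix.vec (M t))
      (fun t => Matrix.vec (filterRHS F (M t) (y t) (u t)))) :
    IsACSolution 0 tD (zSig lam M) (zDot F lam M y u) := by
  rintro (i | i)
  · refine ⟨ContDiffOn.absolutelyContinuousOnInterval (ContDiff.contDiffOn ?_), ae_of_all _ fun t => ?_⟩
    · simp only [zSig, Sum.elim_inl, chi]
      fun_prop
    · exact hasDerivAt_pi.1 ((chi_spec lam).2 t) i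
  · exact hM i

end Signals

/-! ### Gram matrices -/

section Gram

variable {ι : Type*} [Fintype ι] {τ : ℝ} {w : ℝ → ι → ℝ}

theorem gramSig_mulVec (hint : ∀ i j, IntervalIntegrable (fun s => w s i * w s j) volume 0 τ)
    (c : ι → ℝ) (i : ι) : (gramSig τ w *ᵥ c) i = ∫ s in (0 : ℝ)..τ, w s i * (c ⬝ᵥ w s) := by
  simp only [Matrix.mulVec, dotProduct, gramSig, Matrix.of_apply, Finset.mul_sum]
  rw [intervalIntegral.integral_finsetSum fun j _ => by
    have := (hint i j).mul_const (c j)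
    exact this.congr fun s _ => by ring]
  refine Finset.sum_congr rfl fun j _ => ?_
  rw [← intervalIntegral.integral_mul_const]
  exact intervalIntegral.integral_congr fun s _ => by ring

theorem dotProduct_gramSig_mulVec
    (hint : ∀ i j, IntervalIntegrable (fun s => w s i * w s j) volume 0 τ) (c : ι → ℝ) :
    c ⬝ᵥ gramSig τ w *ᵥ c = ∫ s in (0 : ℝ)..τ, (c ⬝ᵥ w s) ^ 2 := by
  rw [dotProduct]
  simp only [gramSig_mulVec hint]
  have hint' : ∀ i, IntervalIntegrable (fun s => c i * (w s i * (c ⬝ᵥ w s))) volume 0 τ := by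
    intro i
    have : IntervalIntegrable (fun s => ∑ j, c i * c j * (w s i * w s j)) volume 0 τ := by
      simpa only [Finset.sum_fn] using
        IntervalIntegrable.sum Finset.univ fun j _ => (hint i j).const_mul (c i * c j)
    refine this.congr fun s _ => ?_
    simp only [dotProduct, Finset.mul_sum]
    exact Finset.sum_congr rfl fun j _ => by ring
  simp only [← intervalIntegral.integral_const_mul]
  rw [← intervalIntegral.integral_finsetSum fun i _ => hint' i]
  refine intervalIntegral.integral_congr fun s _ => ?_
  simp only [sq]
  nth_rewrite 2 [dotProduct]
  rw [Finset.sum_mul]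
  exact Finset.sum_congr rfl fun i _ => by ring

theorem gramSig_mulVec_eq_zero_of_ae (hτ : 0 ≤ τ)
    (hint : ∀ i j, IntervalIntegrable (fun s => w s i * w s j) volume 0 τ) {c : ι → ℝ}
    (hc : ∀ᵐ t ∂(volume.restrict (Icc 0 τ)), c ⬝ᵥ w t = 0) : gramSig τ w *ᵥ c = 0 := by
  ext i
  rw [gramSig_mulVec hint, Pi.zero_apply]
  refine intervalIntegral.integral_zero_ae ?_
  rw [ae_restrict_iff' measurableSet_Icc] at hc
  filter_upwards [hc] with t ht hmem
  rw [uIoc_of_le hτ] at hmem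
  rw [ht (Ioc_subset_Icc_self hmem), mul_zero]

theorem intervalIntegrable_mul_of_continuousOn {ι : Type*} {w : ℝ → ι → ℝ} (hτ : 0 ≤ τ) (hw : ContinuousOn w (Icc 0 τ))
    (i j : ι) : IntervalIntegrable (fun s => w s i * w s j) volume 0 τ := by
  rw [continuousOn_pi] at hw
  refine ContinuousOn.intervalIntegrable ?_
  rw [uIcc_of_le hτ]
  exact (hw i).mul (hw j)

/-- The integral of `(c · w)²` is zero, and continuity gives vanishing at every instant rather than
almost every one, as the sampling instants require. -/
theorem dotProduct_eq_zero_of_gramSig_mulVec_eq_zero (hτ : 0 < τ) (hw : ContinuousOn w (Icc 0 τ))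
    {c : ι → ℝ} (hc : gramSig τ w *ᵥ c = 0) : ∀ t ∈ Icc 0 τ, c ⬝ᵥ w t = 0 := by
  by_contra! h
  obtain ⟨t, ht, h⟩ := h
  have h1 := dotProduct_gramSig_mulVec (intervalIntegrable_mul_of_continuousOn hτ.le hw) c
  rw [hc, dotProduct_zero] at h1
  have hcont : ContinuousOn (fun s => (c ⬝ᵥ w s) ^ 2) (Icc 0 τ) := by
    rw [continuousOn_pi] at hw
    unfold dotProduct
    exact (continuousOn_finsetSum _ fun i _ => continuousOn_const.mul (hw i)).pow 2
  have := intervalIntegral.integral_pos hτ hcont (fun s _ => sq_nonneg _) ⟨t, ht, by positivity⟩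
  exact this.ne h1

theorem gramSig_isSymm {ι : Type*} (τ : ℝ) (w : ℝ → ι → ℝ) : (gramSig τ w)ᵀ = gramSig τ w := by
  ext i j
  simp only [gramSig, Matrix.transpose_apply, Matrix.of_apply, mul_comm]

end Gram

/-! ### Piecewise continuous signals -/

section PiecewiseContinuous

variable {ι : Type*} [Fintype ι] {a b : ℝ} {u : ℝ → ι → ℝ}

/-- Near each point the one-sided limits and the value at the point bound `u`; compactness makes the
bound uniform. -/
theorem PiecewiseContinuousOn.exists_bound (hu : PiecewiseContinuousOn u a b) :
    ∃ K, ∀ t ∈ Icc a b, ‖u t‖ ≤ K := by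
  refine isCompact_Icc.induction_on (p := fun s => ∃ K, ∀ t ∈ s, ‖u t‖ ≤ K) ⟨0, by simp⟩ ?_ ?_ ?_
  · rintro s t hst ⟨K, hK⟩
    exact ⟨K, fun r hr => hK r (hst hr)⟩
  · rintro s t ⟨K, hK⟩ ⟨K', hK'⟩
    exact ⟨max K K', fun r hr => hr.elim (fun h => (hK r h).trans (le_max_left _ _))
      fun h => (hK' r h).trans (le_max_right _ _)⟩
  · intro t ht
    have hR : ∃ K, ∀ᶠ s in 𝓝[Icc a b ∩ Ioi t] t, ‖u s‖ ≤ K := by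
      rcases ht.2.lt_or_eq with h | h
      · obtain ⟨v, hv⟩ := hu.2.1 t ⟨ht.1, h⟩
        exact ⟨‖v‖ + 1, (hv.norm.eventually (eventually_le_nhds (lt_add_one _))).filter_mono
          (nhdsWithin_mono _ inter_subset_right)⟩
      · have : Icc a b ∩ Ioi t = ∅ := by
          ext s; simp only [mem_inter_iff, mem_Icc, mem_Ioi, mem_empty_iff_false, iff_false]
          rintro ⟨⟨-, h1⟩, h2⟩
          linarith
        exact ⟨0, by simp [this]⟩
    have hL : ∃ K, ∀ᶠ s in 𝓝[Icc a b ∩ Iio t] t, ‖u s‖ ≤ K := by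
      rcases ht.1.lt_or_eq with h | h
      · obtain ⟨v, hv⟩ := hu.2.2 t ⟨h, ht.2⟩
        exact ⟨‖v‖ + 1, (hv.norm.eventually (eventually_le_nhds (lt_add_one _))).filter_mono
          (nhdsWithin_mono _ inter_subset_right)⟩
      · have : Icc a b ∩ Iio t = ∅ := by
          ext s; simp only [mem_inter_iff, mem_Icc, mem_Iio, mem_empty_iff_false, iff_false]
          rintro ⟨⟨h1, -⟩, h2⟩
          linarith
        exact ⟨0, by simp [this]⟩
    obtain ⟨K₁, h₁⟩ := hR
    obtain ⟨K₂, h₂⟩ := hL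
    set K := max (max K₁ K₂) ‖u t‖
    refine ⟨{s | ‖u s‖ ≤ K}, ?_, K, fun s hs => hs⟩
    have hsub : Icc a b ⊆ (Icc a b ∩ Ioi t) ∪ (Icc a b ∩ Iio t) ∪ {t} := by
      intro s hs
      rcases lt_trichotomy s t with h | h | h
      · exact .inl (.inr ⟨hs, h⟩)
      · exact .inr h
      · exact .inl (.inl ⟨hs, h⟩)
    refine nhdsWithin_mono _ hsub ?_
    rw [nhdsWithin_union, nhdsWithin_union, nhdsWithin_singleton]
    refine Filter.mem_sup.2 ⟨Filter.mem_sup.2 ⟨?_, ?_⟩, ?_⟩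
    · filter_upwards [h₁] with s hs
      exact hs.trans ((le_max_left _ _).trans (le_max_left _ _))
    · filter_upwards [h₂] with s hs
      exact hs.trans ((le_max_right _ _).trans (le_max_left _ _))
    · exact Filter.mem_pure.2 (le_max_right (max K₁ K₂) ‖u t‖)

theorem PiecewiseContinuousOn.aestronglyMeasurable (hu : PiecewiseContinuousOn u a b) :
    AEStronglyMeasurable u (volume.restrict (Icc a b)) := by
  obtain ⟨S, hS⟩ := hu.1
  have hcont : ContinuousOn u (Icc a b \ S) := fun t ht =>
    (hS t ht.1 ht.2).mono sdiff_subset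
  have hae : (Icc a b \ S : Set ℝ) =ᵐ[volume] Icc a b :=
    sdiff_null_ae_eq_self (S.countable_toSet.measure_zero volume)
  rw [← Measure.restrict_congr_set hae]
  exact hcont.aestronglyMeasurable (measurableSet_Icc.diff S.measurableSet)

theorem intervalIntegrable_mul_of_bounded {w : ℝ → ι → ℝ} {τ : ℝ} (hτ : 0 ≤ τ)
    (hm : AEStronglyMeasurable w (volume.restrict (Icc 0 τ)))
    (hb : ∃ K, ∀ t ∈ Icc 0 τ, ‖w t‖ ≤ K) (i j : ι) :
    IntervalIntegrable (fun s => w s i * w s j) volume 0 τ := by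
  obtain ⟨K, hK⟩ := hb
  have hmi : ∀ i, AEStronglyMeasurable (fun s => w s i) (volume.restrict (Icc 0 τ)) := fun i =>
    (continuous_apply i).comp_aestronglyMeasurable hm
  rw [intervalIntegrable_iff_integrableOn_Icc_of_le hτ]
  refine Integrable.of_bound ((hmi i).mul (hmi j)) (K * K) ?_
  filter_upwards [ae_restrict_mem measurableSet_Icc] with s hs
  rw [norm_mul]
  exact mul_le_mul ((norm_le_pi_norm _ _).trans (hK s hs)) ((norm_le_pi_norm _ _).trans (hK s hs))
    (norm_nonneg _) ((norm_nonneg _).trans (hK s hs))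

end PiecewiseContinuous

/-! ### Sampling -/

section Sampling

/-- A functional that vanishes on all values of `w` would be a kernel vector of the Gram matrix. -/
theorem span_image_eq_top_of_posDef_gramSig {ι : Type*} [Fintype ι] {τ : ℝ} {w : ℝ → ι → ℝ}
    (hτ : 0 ≤ τ) (hint : ∀ i j, IntervalIntegrable (fun s => w s i * w s j) volume 0 τ)
    (hpos : (gramSig τ w).PosDef) : Submodule.span ℝ (w '' Icc 0 τ) = ⊤ := by
  classical
  by_contra h
  obtain ⟨f, hf, hle⟩ := Submodule.exists_le_ker_of_lt_top _ (lt_top_iff_ne_top.2 h)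
  set c : ι → ℝ := fun i => f (Pi.single i 1) with hc
  have hfc : ∀ v, f v = c ⬝ᵥ v := by
    intro v
    conv_lhs => rw [pi_eq_sum_univ' v]
    simp [hc, dotProduct, mul_comm]
  have hzero : ∀ t ∈ Icc 0 τ, c ⬝ᵥ w t = 0 := by
    intro t ht
    rw [← hfc]
    exact hle (Submodule.subset_span ⟨t, ht, rfl⟩)
  have hg : gramSig τ w *ᵥ c = 0 := gramSig_mulVec_eq_zero_of_ae hτ hint
    ((ae_restrict_mem measurableSet_Icc).mono hzero)
  have hc0 : c ≠ 0 := by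
    intro h0
    apply hf
    ext v
    simp [hfc, h0]
  have := hpos.dotProduct_mulVec_pos hc0
  rw [hg, dotProduct_zero] at this
  exact this.false

theorem exists_isSampling {m l : ℕ} {tD : ℝ} (htD : 0 ≤ tD) {za : ℝ → Fin l → ℝ}
    {u : ℝ → Fin m → ℝ}
    (hspan : Submodule.span ℝ ((fun t => Sum.elim (za t) (u t)) '' Icc 0 tD) = ⊤) :
    ∃ N : ℕ, 1 ≤ N ∧ ∃ ts : Fin N → ℝ, IsSampling tD za u ts := by
  classical
  set w : ℝ → Fin l ⊕ Fin m → ℝ := fun t => Sum.elim (za t) (u t) with hw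
  obtain ⟨s, hs, hspan'⟩ := Submodule.fg_span_iff_fg_span_finset_subset (R := ℝ) (w '' Icc 0 tD) |>.1
    (by rw [hspan]; exact Module.Finite.fg_top)
  obtain ⟨S, hS, rfl⟩ := Finset.subset_set_image_iff.1 hs
  -- A finite set of instants already spans; adding `0` ensures `N ≥ 1` even when `l + m = 0`.
  set S' := insert 0 S with hS'
  have hS'sub : ∀ t ∈ S', t ∈ Icc 0 tD := by
    intro t ht
    rcases Finset.mem_insert.1 ht with rfl | h
    · exact ⟨le_rfl, htD⟩
    · exact hS h
  refine ⟨S'.card, Finset.card_pos.2 ⟨0, Finset.mem_insert_self _ _⟩, S'.orderEmbOfFin rfl,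
    (S'.orderEmbOfFin rfl).strictMono, fun j => hS'sub _ (Finset.orderEmbOfFin_mem _ _ _), ?_⟩
  rw [Matrix.rank_eq_finrank_span_cols]
  have htop : Submodule.span ℝ (Set.range (Matrix.fromRows (batch za (S'.orderEmbOfFin rfl))
      (batch u (S'.orderEmbOfFin rfl))).col) = ⊤ := by
    rw [eq_top_iff, ← hspan, hspan']
    refine Submodule.span_mono ?_
    intro v hv
    obtain ⟨t, ht, rfl⟩ := Finset.mem_image.1 (Finset.mem_coe.1 hv)
    have ht' : t ∈ Set.range (S'.orderEmbOfFin rfl) := by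
      rw [Finset.range_orderEmbOfFin]
      exact Finset.mem_insert_of_mem ht
    obtain ⟨j, rfl⟩ := ht'
    refine ⟨j, ?_⟩
    ext (i | i) <;> rfl
  rw [htop, finrank_top, Module.finrank_pi]
  simp

end Sampling

/-! ### Data-driven stabilization of the excited part -/

section Decomposition

variable {ι κ : Type*} [Fintype ι] [DecidableEq ι] [Fintype κ] {l k : ℕ}
  {Tz : Matrix (Fin l ⊕ Fin k) ι ℝ}

theorem mulVec_row_of_orth {ι : Type*} [Fintype ι] {Tz : Matrix (Fin l ⊕ Fin k) ι ℝ} (h : Tz * Tzᵀ = 1) (a : Fin l ⊕ Fin k) :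
    Tz *ᵥ Tz a = Pi.single a 1 := by
  ext b
  have := congrFun (congrFun h b) a
  rw [Matrix.one_apply] at this
  rw [Pi.single_apply, ← this]
  rfl

theorem IsDecomposition.mulVec_row_inr {Zg : Matrix ι ι ℝ} (h : IsDecomposition Zg Tz)
    (j : Fin k) : Zg *ᵥ Tz (Sum.inr j) = 0 := by
  obtain ⟨σ, -, -, hσ⟩ := h.svd
  rw [hσ, ← Matrix.mulVec_mulVec, mulVec_row_of_orth h.orth_left, ← Matrix.mulVec_mulVec]
  have : Matrix.diagonal (Sum.elim σ (0 : Fin k → ℝ)) *ᵥ Pi.single (Sum.inr j) 1 = 0 := by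
    ext a
    rw [Matrix.mulVec_diagonal]
    rcases a with a | a <;> simp
  rw [this, Matrix.mulVec_zero]

theorem IsDecomposition.mulVec_inl_eq_zero {Zg : Matrix ι ι ℝ} (h : IsDecomposition Zg Tz)
    {c : ι → ℝ} (hc : Zg *ᵥ c = 0) (i : Fin l) : (Tz *ᵥ c) (Sum.inl i) = 0 := by
  obtain ⟨σ, -, hpos, hσ⟩ := h.svd
  have h1 : Tz *ᵥ (Zg *ᵥ c) = Matrix.diagonal (Sum.elim σ (0 : Fin k → ℝ)) *ᵥ (Tz *ᵥ c) := by
    rw [hσ, Matrix.mulVec_mulVec, Matrix.mulVec_mulVec, ← Matrix.mul_assoc, ← Matrix.mul_assoc,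
      h.orth_left, Matrix.one_mul]
  rw [hc, Matrix.mulVec_zero] at h1
  have h2 := congrFun h1 (Sum.inl i)
  rw [Matrix.mulVec_diagonal] at h2
  simpa [(hpos i).ne'] using h2.symm

/-- The columns of `B` lie in the range of `Zg`, which by symmetry is orthogonal to its kernel, and
the last rows of `Tz` lie in that kernel. -/
theorem IsDecomposition.toRows₂_mul_eq_zero {Zg : Matrix ι ι ℝ} (h : IsDecomposition Zg Tz)
    (hsymm : Zgᵀ = Zg) {A : Matrix ι ι ℝ} {B : Matrix ι κ ℝ}
    (hrange : LinearMap.range (reachMatrix A B).mulVecLin ≤ LinearMap.range Zg.mulVecLin) :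
    (Tz * B).toRows₂ = 0 := by
  classical
  ext j c
  rcases isEmpty_or_nonempty ι with hι | hι
  · simp [Matrix.toRows₂, Matrix.mul_apply]
  have hmem : B.col c ∈ LinearMap.range (reachMatrix A B).mulVecLin := by
    -- The index `0` picks out the block `A ^ 0 * B` of the reachability matrix.
    refine ⟨Pi.single (⟨0, Fintype.card_pos⟩, c) 1, ?_⟩
    rw [Matrix.mulVecLin_apply, Matrix.mulVec_single_one]
    ext i
    simp [reachMatrix]
  obtain ⟨v, hv⟩ := hrange hmem
  have h1 : (Tz * B).toRows₂ j c = Tz (Sum.inr j) ⬝ᵥ B.col c := rfl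
  rw [h1, ← hv, Matrix.mulVecLin_apply, Matrix.dotProduct_mulVec, ← Matrix.mulVec_transpose, hsymm,
    h.mulVec_row_inr, zero_dotProduct]
  rfl

end Decomposition

/-! ### Excited and unexcited blocks, and the LMI on the excited block -/

section BlockStructure

variable {ι : Type*} [Fintype ι] [DecidableEq ι] {m l k : ℕ} {Tz : Matrix (Fin l ⊕ Fin k) ι ℝ}
  {A : Matrix ι ι ℝ} {B : Matrix ι (Fin m) ℝ}

/-- The closed loop is block triangular in the coordinates `Tz`. Its second diagonal block is
independent of `K`, so one stabilizing gain certifies that block for all gains. -/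
theorem isHurwitz_add_mul_iff (hTz : Tz * Tzᵀ = 1) (hTz' : Tzᵀ * Tz = 1)
    (hB : (Tz * B).toRows₂ = 0) (hA : (Tz * A * Tzᵀ).toBlocks₂₁ = 0) (K : Matrix (Fin m) ι ℝ) :
    IsHurwitz (A + B * K) ↔
      IsHurwitz ((Tz * A * Tzᵀ).toBlocks₁₁ + (Tz * B).toRows₁ * (K * Tzᵀ).toCols₁) ∧
        IsHurwitz (Tz * A * Tzᵀ).toBlocks₂₂ := by
  have h1 : Tz * (A + B * K) * Tzᵀ = Matrix.fromBlocks
      ((Tz * A * Tzᵀ).toBlocks₁₁ + (Tz * B).toRows₁ * (K * Tzᵀ).toCols₁)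
      ((Tz * A * Tzᵀ).toBlocks₁₂ + (Tz * B).toRows₁ * (K * Tzᵀ).toCols₂) 0
      (Tz * A * Tzᵀ).toBlocks₂₂ := by
    have h2 : Tz * (A + B * K) * Tzᵀ = Tz * A * Tzᵀ + (Tz * B) * (K * Tzᵀ) := by
      simp only [Matrix.mul_add, Matrix.add_mul, Matrix.mul_assoc]
    rw [h2]
    conv_lhs => rw [← Matrix.fromBlocks_toBlocks (Tz * A * Tzᵀ), ← Matrix.fromRows_toRows (Tz * B),
      ← Matrix.fromCols_toCols (K * Tzᵀ), hA, hB, Matrix.fromRows_mul_fromCols,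
      Matrix.fromBlocks_add]
    simp
  rw [← isHurwitz_fromBlocks_zero₂₁, ← h1]
  refine ⟨fun h => h.conj hTz hTz', fun h => ?_⟩
  have h3 := h.conj hTz' hTz
  rwa [← Matrix.mul_assoc, ← Matrix.mul_assoc, hTz', Matrix.one_mul, Matrix.mul_assoc, hTz',
    Matrix.mul_one] at h3

theorem mulVec_add_comp_inl (hTz' : Tzᵀ * Tz = 1) {w : ι → ℝ}
    (hw : ∀ j, (Tz *ᵥ w) (Sum.inr j) = 0) (v : Fin m → ℝ) (i : Fin l) :
    (Tz *ᵥ (A *ᵥ w + B *ᵥ v)) (Sum.inl i) =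
      ((Tz * A * Tzᵀ).toBlocks₁₁ *ᵥ (fun i => (Tz *ᵥ w) (Sum.inl i)) +
        (Tz * B).toRows₁ *ᵥ v) i := by
  have h1 : Tz *ᵥ (A *ᵥ w + B *ᵥ v) = (Tz * A * Tzᵀ) *ᵥ (Tz *ᵥ w) + (Tz * B) *ᵥ v := by
    rw [Matrix.mulVec_add, Matrix.mulVec_mulVec, Matrix.mulVec_mulVec, Matrix.mulVec_mulVec,
      Matrix.mul_assoc (Tz * A), hTz', Matrix.mul_one]
  rw [h1, Pi.add_apply, Pi.add_apply]
  congr 1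
  simp [Matrix.mulVec, dotProduct, Fintype.sum_sum_type, Matrix.toBlocks₁₁] at hw ⊢
  simp [hw]

variable {N : ℕ} {Aa : Matrix (Fin l) (Fin l) ℝ} {Ba : Matrix (Fin l) (Fin m) ℝ}
  {Za : Matrix (Fin l) (Fin N) ℝ} {U : Matrix (Fin m) (Fin N) ℝ}

theorem exists_right_inverse_of_rank {α β : Type*} [Fintype α] [DecidableEq α] [Fintype β]
    {X : Matrix α β ℝ} (h : X.rank = Fintype.card α) : ∃ R : Matrix β α ℝ, X * R = 1 := by
  classical
  rw [← Matrix.mulVec_surjective_iff_exists_right_inverse]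
  have : LinearMap.range X.mulVecLin = ⊤ := by
    refine Submodule.eq_top_of_finrank_eq ?_
    rw [Module.finrank_pi]
    exact h
  exact LinearMap.range_eq_top.1 this

/-- The LMI is feasible if the pair is stabilizable and the data have full row rank. -/
theorem exists_isLMISolution (hrank : (Matrix.fromRows Za U).rank = l + m)
    {Ka : Matrix (Fin m) (Fin l) ℝ} (hKa : IsHurwitz (Aa + Ba * Ka)) :
    ∃ Q, IsLMISolution Za (Aa * Za + Ba * U) Q := by
  obtain ⟨P, hP, hN⟩ := hKa.exists_lyapunov
  -- A right inverse of the data matrix gives `Q` with `Za Q = P` and `U Q = Ka P`.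
  obtain ⟨R, hR⟩ := exists_right_inverse_of_rank (X := Matrix.fromRows Za U) (by simpa using hrank)
  have hPt : Pᵀ = P := by simpa using hP.isHermitian.eq
  have h1 : Matrix.fromRows Za U * (R * Matrix.fromRows P (Ka * P)) =
      Matrix.fromRows P (Ka * P) := by
    rw [← Matrix.mul_assoc, hR, Matrix.one_mul]
  rw [Matrix.fromRows_mul, Matrix.fromRows_inj.eq_iff] at h1
  obtain ⟨hZ, hU⟩ := h1
  have h2 : (Aa * Za + Ba * U) * (R * Matrix.fromRows P (Ka * P)) = (Aa + Ba * Ka) * P := by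
    rw [Matrix.add_mul, Matrix.mul_assoc, Matrix.mul_assoc, hZ, hU, Matrix.add_mul,
      Matrix.mul_assoc]
  refine ⟨R * Matrix.fromRows P (Ka * P), ?_, ?_, ?_⟩
  · rw [← Matrix.transpose_mul, hZ, hPt]
  · rwa [hZ]
  · rw [← Matrix.transpose_mul, h2, Matrix.transpose_mul, hPt]
    exact hN

/-- Each solution of the LMI gives a stabilizing gain. -/
theorem IsLMISolution.isHurwitz {Q : Matrix (Fin N) (Fin l) ℝ}
    (hQ : IsLMISolution Za (Aa * Za + Ba * U) Q) :
    IsHurwitz (Aa + Ba * (U * Q * (Za * Q)⁻¹)) := by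
  have hdet : IsUnit (Za * Q).det := (Matrix.isUnit_iff_isUnit_det _).1 hQ.pos.isUnit
  have hsymm : (Za * Q)ᵀ = Za * Q := by rw [Matrix.transpose_mul, hQ.symm]
  -- The unknown pair enters only through the measured derivative batch, so the LMI is the Lyapunov
  -- inequality with `P = Za Q`.
  have h1 : (Aa + Ba * (U * Q * (Za * Q)⁻¹)) * (Za * Q) = (Aa * Za + Ba * U) * Q := by
    rw [Matrix.add_mul, Matrix.mul_assoc Ba, Matrix.nonsing_inv_mul_cancel_right _ _ hdet,
      Matrix.add_mul, Matrix.mul_assoc, Matrix.mul_assoc]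
  refine isHurwitz_of_lyapunov hQ.pos ?_
  have h2 : Za * Q * (Aa + Ba * (U * Q * (Za * Q)⁻¹))ᵀ = Qᵀ * (Aa * Za + Ba * U)ᵀ := by
    rw [← Matrix.transpose_mul, ← h1, Matrix.transpose_mul, hsymm]
  rw [h1, h2]
  exact hQ.neg

theorem gain_mul_transpose_toCols₁ {ι : Type*} [Fintype ι] {Tz : Matrix (Fin l ⊕ Fin k) ι ℝ}
    (hTz : Tz * Tzᵀ = 1) (Q : Matrix (Fin N) (Fin l) ℝ) :
    (gain Za U Q Tz * Tzᵀ).toCols₁ = U * Q * (Za * Q)⁻¹ := by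
  rw [gain, Matrix.mul_assoc, hTz, Matrix.mul_one, Matrix.toCols₁_fromCols]

end BlockStructure

/-! ### The extended system along the data -/

section ExtendedSystem

variable {n m p : ℕ} {A : Matrix (Fin n) (Fin n) ℝ} {B : Matrix (Fin n) (Fin m) ℝ}
  {C : Matrix (Fin p) (Fin n) ℝ} {F : Matrix (Fin n) (Fin n) ℝ} {lam : Fin n → ℝ} {tD : ℝ}
  {u : ℝ → Fin m → ℝ} {x : ℝ → Fin n → ℝ} {y : ℝ → Fin p → ℝ}
  {M : ℝ → Matrix (Fin n) (MuIdx n m p) ℝ} {T : Matrix (Fin n) (Fin n) ℝ}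
  {L : Matrix (Fin n) (Fin p) ℝ} {Γ : Matrix (Fin n) (Fin n) ℝ}

theorem isHurwitz_diagonal_of_hasEigenvalue (hF : IsHurwitz F) (hlam : Function.Injective lam)
    (heig : ∀ i, Module.End.HasEigenvalue (Matrix.toLin' F) (lam i)) :
    IsHurwitz (Matrix.diagonal lam) := by
  obtain ⟨W, hW, hFW⟩ := exists_mul_eq_mul_diagonal hlam heig
  have := hF.conj (P := W⁻¹) (R := W) (Matrix.nonsing_inv_mul _ hW) (Matrix.mul_nonsing_inv _ hW)
  rwa [Matrix.mul_assoc, hFW, Matrix.nonsing_inv_mul_cancel_left _ _ hW] at this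

/-- The input does not act on `χ`, so `Λ` remains a diagonal block under every feedback. -/
theorem isHurwitz_Ae_add_iff (hΛ : IsHurwitz (Matrix.diagonal lam))
    (Ke : Matrix (Fin m) (ZIdx n m p) ℝ) :
    IsHurwitz (Ae B C F lam T L Γ + Be n m p * Ke) ↔
      IsHurwitz (Axi B C F T L + Bxi n m p * Ke.toCols₂) := by
  have h1 : Ae B C F lam T L Γ + Be n m p * Ke = Matrix.fromBlocks (Matrix.diagonal lam) 0
      (Lxi n m p * C * T⁻¹ * Γ + Bxi n m p * Ke.toCols₁)
      (Axi B C F T L + Bxi n m p * Ke.toCols₂) := by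
    rw [Ae, Be]
    conv_lhs => rw [← Matrix.fromCols_toCols Ke, Matrix.fromRows_mul_fromCols,
      Matrix.fromBlocks_add]
    simp
  rw [h1, isHurwitz_fromBlocks_zero₁₂]
  exact and_iff_right hΛ

variable {l k : ℕ} {Tz : Matrix (Fin l ⊕ Fin k) (ZIdx n m p) ℝ}

theorem mulVec_zSig_inr_eq_zero (htD : 0 < tD)
    (hz : IsACSolution 0 tD (zSig lam M) (zDot F lam M y u))
    (hdec : IsDecomposition (gramSig tD (zSig lam M)) Tz) {t : ℝ} (ht : t ∈ Icc 0 tD) (j : Fin k) :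
    (Tz *ᵥ zSig lam M t) (Sum.inr j) = 0 :=
  dotProduct_eq_zero_of_gramSig_mulVec_eq_zero htD (hz.continuousOn htD.le)
    (hdec.mulVec_row_inr j) t ht

/-- The subspace in which `z` evolves is invariant under the state matrix. -/
theorem toBlocks₂₁_conj_eq_zero (htD : 0 < tD)
    (hz : IsACSolution 0 tD (zSig lam M) (zDot F lam M y u))
    (hdot : ∀ t ∈ Icc 0 tD, zDot F lam M y u t =
      Ae B C F lam T L Γ *ᵥ zSig lam M t + Be n m p *ᵥ u t)
    (hdec : IsDecomposition (gramSig tD (zSig lam M)) Tz)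
    (hBe : (Tz * Be n m p).toRows₂ = 0) :
    (Tz * Ae B C F lam T L Γ * Tzᵀ).toBlocks₂₁ = 0 := by
  ext j i
  set c : ZIdx n m p → ℝ := (Tz * Ae B C F lam T L Γ) (Sum.inr j) with hc
  have hae : ∀ᵐ t ∂(volume.restrict (Icc 0 tD)), c ⬝ᵥ zSig lam M t = 0 := by
    have hd := (hz.dotProduct (Tz (Sum.inr j))).2
    -- At interior points the vanishing of this coordinate holds on a neighbourhood, so its
    -- two-sided derivative is zero.
    rw [Measure.restrict_congr_set Ioo_ae_eq_Icc.symm] at hd ⊢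
    filter_upwards [hd, ae_restrict_mem measurableSet_Ioo] with t ht hmem
    have h0 : HasDerivAt (fun s => Tz (Sum.inr j) ⬝ᵥ zSig lam M s) 0 t := by
      refine (hasDerivAt_const t (0 : ℝ)).congr_of_eventuallyEq ?_
      filter_upwards [Ioo_mem_nhds hmem.1 hmem.2] with s hs
      exact mulVec_zSig_inr_eq_zero htD hz hdec (Ioo_subset_Icc_self hs) j
    have h1 := ht.unique h0
    rw [hdot t (Ioo_subset_Icc_self hmem), dotProduct_add, Matrix.dotProduct_mulVec,
      Matrix.dotProduct_mulVec] at h1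
    have h2 : Tz (Sum.inr j) ᵥ* Be n m p = 0 := by
      ext q
      exact congrFun (congrFun hBe j) q
    rw [h2, zero_dotProduct, add_zero] at h1
    exact h1
  -- Thus `c` lies in the kernel of the Gram matrix, where the first `l` coordinates under `Tz`
  -- vanish; these are the entries of the lower left block.
  have hg := gramSig_mulVec_eq_zero_of_ae htD.le
    (intervalIntegrable_mul_of_continuousOn htD.le (hz.continuousOn htD.le)) hae
  have h3 := hdec.mulVec_inl_eq_zero hg i
  have h4 : (Tz * Ae B C F lam T L Γ * Tzᵀ).toBlocks₂₁ j i = c ⬝ᵥ Tz (Sum.inl i) := rfl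
  rw [h4, dotProduct_comm]
  exact h3

theorem continuous_partA_map {ι : Type*} [Fintype ι] (Tz : Matrix (Fin l ⊕ Fin k) ι ℝ) :
    Continuous fun v : ι → ℝ => fun i : Fin l => (Tz *ᵥ v) (Sum.inl i) := by
  unfold Matrix.mulVec dotProduct
  fun_prop

theorem aestronglyMeasurable_sumElim_partA {ι : Type*} [Fintype ι] {z : ℝ → ι → ℝ}
    (hz : ContinuousOn z (Icc 0 tD)) (hu : AEStronglyMeasurable u (volume.restrict (Icc 0 tD)))
    (Tz : Matrix (Fin l ⊕ Fin k) ι ℝ) :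
    AEStronglyMeasurable (fun t => Sum.elim (partA Tz z t) (u t))
      (volume.restrict (Icc 0 tD)) := by
  have h1 : AEStronglyMeasurable (partA Tz z) (volume.restrict (Icc 0 tD)) :=
    ((continuous_partA_map Tz).comp_continuousOn hz).aestronglyMeasurable measurableSet_Icc
  have h2 : Continuous fun q : (Fin l → ℝ) × (Fin m → ℝ) => (Sum.elim q.1 q.2 : Fin l ⊕ Fin m → ℝ) := by
    refine continuous_pi ?_
    rintro (i | i)
    · exact (continuous_apply i).comp continuous_fst
    · exact (continuous_apply i).comp continuous_snd
  exact h2.comp_aestronglyMeasurable (h1.prodMk hu)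

theorem exists_bound_sumElim_partA {ι : Type*} [Fintype ι] {z : ℝ → ι → ℝ}
    (hz : ContinuousOn z (Icc 0 tD)) (hu : ∃ K, ∀ t ∈ Icc 0 tD, ‖u t‖ ≤ K)
    (Tz : Matrix (Fin l ⊕ Fin k) ι ℝ) :
    ∃ K, ∀ t ∈ Icc 0 tD, ‖Sum.elim (partA Tz z t) (u t)‖ ≤ K := by
  obtain ⟨K₁, h₁⟩ := isCompact_Icc.exists_bound_of_continuousOn
    ((continuous_partA_map Tz).comp_continuousOn hz)
  obtain ⟨K₂, h₂⟩ := hu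
  refine ⟨max K₁ K₂, fun t ht => ?_⟩
  have h0 := (norm_nonneg _).trans (h₂ t ht)
  refine (pi_norm_le_iff_of_nonneg (h0.trans (le_max_right _ _))).2 ?_
  rintro (i | i)
  · exact (norm_le_pi_norm (partA Tz z t) i).trans ((h₁ t ht).trans (le_max_left _ _))
  · exact (norm_le_pi_norm (u t) i).trans ((h₂ t ht).trans (le_max_right _ _))

end ExtendedSystem

end FilterStab

/-! ### The main theorem -/

theorem mainTheorem1 {n m p : ℕ}
    -- the plant: controllable and observable
    (A : Matrix (Fin n) (Fin n) ℝ) (B : Matrix (Fin n) (Fin m) ℝ) (C : Matrix (Fin p) (Fin n) ℝ)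
    (hAB : IsControllable A B) (hCA : IsObservable C A)
    -- the filter matrix: Hurwitz with the `n` distinct real eigenvalues `lam i`
    (F : Matrix (Fin n) (Fin n) ℝ) (lam : Fin n → ℝ) (hF : IsHurwitz F)
    (hlam : Function.Injective lam)
    (heig : ∀ i, Module.End.HasEigenvalue (Matrix.toLin' F) (lam i))
    -- the experiment on `[0, tD]`, from an arbitrary initial state
    (tD : ℝ) (htD : 0 < tD)
    (u : ℝ → Fin m → ℝ) (hu : PiecewiseContinuousOn u 0 tD)
    (x : ℝ → Fin n → ℝ) (hx : IsACSolution 0 tD x (fun t => A *ᵥ x t + B *ᵥ u t))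
    (y : ℝ → Fin p → ℝ) (hy : ∀ t ∈ Icc 0 tD, y t = C *ᵥ x t)
    -- the filter, run on the data from zero initial state
    (M : ℝ → Matrix (Fin n) (MuIdx n m p) ℝ) (hM0 : M 0 = 0)
    (hM : IsACSolution 0 tD (fun t => Matrix.vec (M t))
      (fun t => Matrix.vec (filterRHS F (M t) (y t) (u t)))) :
    -- the extended system is well defined
    (∃ T L Γ, IsAdmissible A B C F lam tD x M T L Γ) ∧
    ∀ T L Γ, IsAdmissible A B C F lam tD x M T L Γ →
    ∀ (l k : ℕ) (Tz : Matrix (Fin l ⊕ Fin k) (ZIdx n m p) ℝ),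
      IsDecomposition (gramSig tD (zSig lam M)) Tz →
      -- range condition
      LinearMap.range (reachMatrix (Ae B C F lam T L Γ) (Be n m p)).mulVecLin ≤
        LinearMap.range (gramSig tD (zSig lam M)).mulVecLin →
      -- interval excitation
      (gramSig tD (fun t => Sum.elim (partA Tz (zSig lam M) t) (u t))).PosDef →
      -- sampling instants with the rank property exist
      (∃ N : ℕ, 1 ≤ N ∧ ∃ ts : Fin N → ℝ, IsSampling tD (partA Tz (zSig lam M)) u ts) ∧
      -- for all such instants the LMI is feasible, and each of its solutions gives a
      -- stabilizing gain and a stabilizing controller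
      ∀ (N : ℕ), 1 ≤ N → ∀ ts : Fin N → ℝ, IsSampling tD (partA Tz (zSig lam M)) u ts →
        (∃ Q, IsLMISolution (batch (partA Tz (zSig lam M)) ts)
          (batch (partA Tz (zDot F lam M y u)) ts) Q) ∧
        ∀ Q, IsLMISolution (batch (partA Tz (zSig lam M)) ts)
            (batch (partA Tz (zDot F lam M y u)) ts) Q →
          IsHurwitz (Ae B C F lam T L Γ + Be n m p *
            gain (batch (partA Tz (zSig lam M)) ts) (batch u ts) Q Tz) ∧
          FilterControllerStabilizes A B C F
            (gain (batch (partA Tz (zSig lam M)) ts) (batch u ts) Q Tz) := by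
  have hz := isACSolution_zSig (lam := lam) hM
  have hΛ := isHurwitz_diagonal_of_hasEigenvalue hF hlam heig
  refine ⟨exists_isAdmissible hCA hlam heig htD.le hx hy hM, ?_⟩
  intro T L Γ hadm l k Tz hdec hrange hexc
  have hdot := fun t (ht : t ∈ Icc 0 tD) => zDot_eq (u := u) hadm hy ht
  have hzero := fun t (ht : t ∈ Icc 0 tD) => mulVec_zSig_inr_eq_zero htD hz hdec ht
  have hBe := hdec.toRows₂_mul_eq_zero (gramSig_isSymm _ _) hrange
  have hAe := toBlocks₂₁_conj_eq_zero htD hz hdot hdec hBe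
  -- This model-based gain is auxiliary: its excited part makes the LMI feasible, and it certifies
  -- the unexcited block for every data-driven gain.
  obtain ⟨K, hK⟩ := hAB.exists_isHurwitz hlam hF heig
  have hKξ := isHurwitz_Axi_add hadm.nonsing hadm.similar hF hK
  have hK₀ : IsHurwitz (Ae B C F lam T L Γ + Be n m p *
      Matrix.fromCols 0 (K * rowKron (theta B T L) T⁻¹)) := by
    rwa [isHurwitz_Ae_add_iff hΛ, Matrix.toCols₂_fromCols]
  rw [isHurwitz_add_mul_iff hdec.orth_left hdec.orth_right hBe hAe] at hK₀
  refine ⟨exists_isSampling htD.le (span_image_eq_top_of_posDef_gramSig htD.le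
    (intervalIntegrable_mul_of_bounded htD.le ?_ ?_) hexc), ?_⟩
  · exact aestronglyMeasurable_sumElim_partA (hz.continuousOn htD.le) hu.aestronglyMeasurable Tz
  · exact exists_bound_sumElim_partA (hz.continuousOn htD.le) hu.exists_bound Tz
  intro N _ ts hts
  -- The identity is exact at every sampling instant, since `zDot` is the right-hand side evaluated
  -- there and the unexcited coordinates are zero.
  have hbatch : batch (partA Tz (zDot F lam M y u)) ts =
      (Tz * Ae B C F lam T L Γ * Tzᵀ).toBlocks₁₁ * batch (partA Tz (zSig lam M)) ts +
        (Tz * Be n m p).toRows₁ * batch u ts := by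
    ext i j
    have := mulVec_add_comp_inl (A := Ae B C F lam T L Γ) (B := Be n m p) hdec.orth_right
      (hzero _ (hts.mem j)) (u (ts j)) i
    rw [← hdot _ (hts.mem j)] at this
    exact this
  rw [hbatch]
  refine ⟨exists_isLMISolution hts.rank_eq hK₀.1, fun Q hQ => ?_⟩
  have hKe : IsHurwitz (Ae B C F lam T L Γ + Be n m p *
      gain (batch (partA Tz (zSig lam M)) ts) (batch u ts) Q Tz) := by
    rw [isHurwitz_add_mul_iff hdec.orth_left hdec.orth_right hBe hAe,
      gain_mul_transpose_toCols₁ hdec.orth_left]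
    exact ⟨hQ.isHurwitz, hK₀.2⟩
  exact ⟨hKe, filterControllerStabilizes_of_isHurwitz hadm.nonsing hadm.similar hF
    ((isHurwitz_Ae_add_iff hΛ _).1 hKe)⟩
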